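/- Let $n\ge 1$ and let $\mathbb F_n^+$ be the free monoid on $g_1,\dots,g_n$ with identity $g_0$. Let $f=\sum_{\alpha\in\mathbb F_n^+}a_\alpha X_\alpha$ be a positive regular free holomorphic function, i.e. $a_\alpha\ge 0$ for all $\alpha$, $a_{g_0}=0$, $a_{g_i}>0$ for $i=1,\dots,n$, and $\limsup_{k\to\infty}\bigl(\sum_{|\alpha|=k}|a_\alpha|^2\bigr)^{1/2k}<\infty$. All Hilbert spaces are complex. For $X=(X_1,\dots,X_n)\in B(\mathcal H)^n$ and $\alpha=g_{i_1}\cdots g_{i_k}$ write $X_\alpha=X_{i_1}\cdots X_{i_k}$, $X_{g_0}=I$, and $\Phi_{f,X}(Y)=\sum_{|\alpha|\ge1}a_\alpha X_\alpha YX_\alpha^*$ (convergence in the weak operator topology). Let $\mathcal D_f(\mathcal H)$ be the set of those $X$ for which $\Phi_{f,X}(I)$ converges and $\|\Phi_{f,X}(I)\|\le1$; for such $X$ put $\Delta_{f,X}=(I-\Phi_{f,X}(I))^{1/2}$, and call $X$ pure (of class $C_{\cdot0}$) if $\Phi_{f,X}^m(I)\to0$ in the strong operator topology as $m\to\infty$.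 Put $b_{g_0}=1$ and $b_\alpha=\sum_{j=1}^{|\alpha|}\sum_{\gamma_1\cdots\gamma_j=\alpha,\ |\gamma_i|\ge1}a_{\gamma_1}\cdots a_{\gamma_j}$ for $|\alpha|\ge1$. On the full Fock space $F^2(H_n)$, with orthonormal basis $(e_\alpha)_{\alpha\in\mathbb F_n^+}$, let $W_i$ be the bounded operators with $W_ie_\alpha=\sqrt{b_\alpha/b_{g_i\alpha}}\,e_{g_i\alpha}$. Let $F_n^\infty(\mathcal D_f)$ be the algebra of all bounded operators $A$ on $F^2(H_n)$ for which there are $c_\beta\in\mathbb C$ with $\sum_\beta|c_\beta|^2/b_\beta<\infty$ and $Ap=\sum_\beta c_\beta W_\beta p$ for every $p$ in the linear span of the $e_\alpha$. Let $\mathcal P_J$ be a set of polynomials in $n$ noncommuting variables, let $J$ be the $w^*$-closed two-sided ideal of $F_n^\infty(\mathcal D_f)$ generated by $\{q(W_1,\dots,W_n):q\in\mathcal P_J\}$, and assume $J\ne F_n^\infty(\mathcal D_f)$. Put $\mathcal N_J=F^2(H_n)\ominus\overline{\operatorname{span}}\,JF^2(H_n)$, $B_i=P_{\mathcal N_J}W_i|_{\mathcal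 N_J}$, and $$\mathcal V_{f,J}(\mathcal H)=\{X\in\mathcal D_f(\mathcal H):\ q(X_1,\dots,X_n)=0\ \text{for all } q\in\mathcal P_J\}.$$ **Theorem.** Let $\mathcal H$ be a Hilbert space and $T=(T_1,\dots,T_n)\in\mathcal V_{f,J}(\mathcal H)$. Then there exist a Hilbert space $\mathcal K$, an $n$-tuple $U=(U_1,\dots,U_n)\in\mathcal V_{f,J}(\mathcal K)$ with $$\sum_{|\alpha|\ge1}a_\alpha U_\alpha U_\alpha^*=I_{\mathcal K},$$ and a linear isometry of $\mathcal H$ into $$\tilde{\mathcal K}=\bigl(\mathcal N_J\otimes\overline{\Delta_{f,T}\mathcal H}\bigr)\oplus\mathcal K$$ such that, with $V_i=\begin{bmatrix}B_i\otimes I_{\overline{\Delta_{f,T}\mathcal H}}&0\\0&U_i\end{bmatrix}$ and with $\mathcal H$ identified with its image in $\tilde{\mathcal K}$, the subspace $\mathcal H$ is co-invariant under each $V_i$ (i.e. $V_i^*\mathcal H\subseteq\mathcal H$) and $$T_i^*=V_i^*|_{\mathcal H},\qquad i=1,\dots,n.$$ Moreover, $\mathcal K$ and $U$ can be chosen so that,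 in addition, $\mathcal K=\{0\}$ if and only if $T$ is pure. -/

import Mathlib

open Filter Topology
open scoped ENNReal TensorProduct InnerProductSpace

noncomputable section

namespace NCVariety

/-! ## Free holomorphic functions -/

/-- A positive regular free holomorphic function `f = ∑ a_α X_α` in `n` noncommuting variables,
given by its coefficients. Elements `α` of the free monoid on `n` generators are words, that is,
lists of letters in `Fin n`. The last field is
`limsup_k (∑_{|α| = k} |a_α|²)^{1/(2k)} < ∞`. -/
structure PosRegFreeHol (n : ℕ) where
  coeff : List (Fin n) → ℝ
  coeff_nonneg : ∀ α, 0 ≤ coeff α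
  coeff_nil : coeff [] = 0
  coeff_letter_pos : ∀ i, 0 < coeff [i]
  limsup_lt_top :
    limsup (fun k : ℕ => ENNReal.ofReal
      ((∑ w : Fin k → Fin n, |coeff (List.ofFn w)| ^ 2) ^ (1 / (2 * (k : ℝ))))) atTop < ⊤

/-! ## The noncommutative domain and the noncommutative variety -/

section Domain

variable {n : ℕ} {H : Type*} [NormedAddCommGroup H] [InnerProductSpace ℂ H] [CompleteSpace H]

/-- `X_α = X_{i₁} ⋯ X_{i_k}` for the word `α = g_{i₁} ⋯ g_{i_k}`, and `X_∅ = I`. -/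
def wordOp (X : Fin n → H →L[ℂ] H) (α : List (Fin n)) : H →L[ℂ] H :=
  (α.map X).prod

/-- The term `a_α X_α Y X_α*`, viewed in `B(H)` with the weak operator topology. -/
def phiTerm (f : PosRegFreeHol n) (X : Fin n → H →L[ℂ] H) (Y : H →L[ℂ] H)
    (α : List (Fin n)) : H →WOT[ℂ] H :=
  ContinuousLinearMapWOT.ofCLM
    ((f.coeff α : ℂ) •
      (wordOp X α ∘L Y ∘L ContinuousLinearMap.adjoint (wordOp X α)))

/-- `Φ_{f,X}(Y) = ∑_{|α| ≥ 1} a_α X_α Y X_α*`, with convergence in the weak operator topology.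
(The coefficient of the empty word is zero.) -/
def phi (f : PosRegFreeHol n) (X : Fin n → H →L[ℂ] H) (Y : H →L[ℂ] H) : H →L[ℂ] H :=
  (∑' α, phiTerm f X Y α).toCLM

variable (H) in
/-- The noncommutative domain `D_f(H)`: the series `∑ a_α X_α X_α*` converges in the weak operator
topology and its sum has norm at most `1`. -/
def domain (f : PosRegFreeHol n) : Set (Fin n → H →L[ℂ] H) :=
  {X | Summable (phiTerm f X 1) ∧ ‖phi f X 1‖ ≤ 1}

variable (H) in
/-- The noncommutative variety `V_{f,J}(H)`, where `J` is generated by the set `P` of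
noncommutative polynomials: the elements of the domain that are annihilated by all `q ∈ P`. -/
def variety (f : PosRegFreeHol n) (P : Set (FreeAlgebra ℂ (Fin n))) :
    Set (Fin n → H →L[ℂ] H) :=
  {X | X ∈ domain H f ∧ ∀ q ∈ P, FreeAlgebra.lift ℂ X q = 0}

/-- `X` is of class `C_{·0}` (pure): `Φ_{f,X}^m(I) → 0` in the strong operator topology. -/
def IsPure (f : PosRegFreeHol n) (X : Fin n → H →L[ℂ] H) : Prop :=
  ∀ h : H, Tendsto (fun m : ℕ => ((phi f X)^[m] 1) h) atTop (𝓝 0)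

/-- The defect operator `Δ_{f,X} = (I - Φ_{f,X}(I))^{1/2}`. -/
def defect (f : PosRegFreeHol n) (X : Fin n → H →L[ℂ] H) : H →L[ℂ] H :=
  CFC.sqrt (1 - phi f X 1)

/-- The closure of the range of the defect operator. -/
def defectSpace (f : PosRegFreeHol n) (X : Fin n → H →L[ℂ] H) : Submodule ℂ H :=
  (LinearMap.range (defect f X).toLinearMap).topologicalClosure

instance (f : PosRegFreeHol n) (X : Fin n → H →L[ℂ] H) : CompleteSpace (defectSpace f X) :=
  inferInstanceAs (CompleteSpace (Submodule.topologicalClosure _))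

end Domain

/-! ## The universal model of the domain -/

section Model

variable {n : ℕ}

/-- The coefficients `b_∅ = 1` and `b_α = ∑_j ∑_{γ₁ ⋯ γ_j = α, |γ_i| ≥ 1} a_{γ₁} ⋯ a_{γ_j}`.
The factorizations of `α` into nonempty words correspond to the compositions of the integer `|α|`
(the lengths of the factors). -/
def bCoeff (f : PosRegFreeHol n) (α : List (Fin n)) : ℝ :=
  ∑ c : Composition α.length, ((α.splitWrtComposition c).map f.coeff).prod

/-- The full Fock space of `ℂⁿ`, with its orthonormal basis `e_α` indexed by words. -/
abbrev Fock (n : ℕ) : Type := lp (fun _ : List (Fin n) => ℂ) 2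

/-- The basis vector `e_α = e_{i₁} ⊗ ⋯ ⊗ e_{i_k}`. -/
def basisVec (α : List (Fin n)) : Fock n := lp.single 2 α (1 : ℂ)

theorem prod_coeff_nonneg (f : PosRegFreeHol n) (L : List (List (Fin n))) :
    0 ≤ (L.map f.coeff).prod := by
  apply List.prod_nonneg
  intro x hx
  obtain ⟨α, -, rfl⟩ := List.mem_map.1 hx
  exact f.coeff_nonneg α

theorem bCoeff_nonneg (f : PosRegFreeHol n) (α : List (Fin n)) : 0 ≤ bCoeff f α :=
  Finset.sum_nonneg fun _ _ => prod_coeff_nonneg f _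

theorem bCoeff_nil (f : PosRegFreeHol n) : bCoeff f [] = 1 := by
  have h : ∀ c : Composition ([] : List (Fin n)).length,
      ((([] : List (Fin n)).splitWrtComposition c).map f.coeff).prod = 1 := by
    intro c
    have : ([] : List (Fin n)).splitWrtComposition c = [] := by
      rw [← List.length_eq_zero_iff, List.length_splitWrtComposition]
      exact Nat.le_zero.1 c.length_le
    simp [this]
  unfold bCoeff
  rw [Finset.sum_congr rfl fun c _ => h c]
  simp [composition_card]

/-- Prepending a block of size one to a composition. -/
def consOne (i : Fin n) (α : List (Fin n)) (c : Composition α.length) :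
    Composition (i :: α).length where
  blocks := 1 :: c.blocks
  blocks_pos := by
    intro k hk
    rcases List.mem_cons.1 hk with rfl | hk
    · exact Nat.one_pos
    · exact c.blocks_pos hk
  blocks_sum := by
    rw [List.sum_cons, c.blocks_sum, List.length_cons, Nat.add_comm]

theorem coeff_mul_bCoeff_le (f : PosRegFreeHol n) (i : Fin n) (α : List (Fin n)) :
    f.coeff [i] * bCoeff f α ≤ bCoeff f (i :: α) := by
  classical
  have hinj : Function.Injective (consOne i α) := by
    intro c d h
    have := congrArg Composition.blocks h
    exact Composition.ext (List.cons.inj this).2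
  have hs : ∀ c : Composition α.length,
      (((i :: α).splitWrtComposition (consOne i α c)).map f.coeff).prod
        = f.coeff [i] * ((α.splitWrtComposition c).map f.coeff).prod := by
    intro c
    simp [List.splitWrtComposition, consOne, List.splitWrtCompositionAux_cons]
  unfold bCoeff
  rw [Finset.mul_sum]
  calc ∑ c : Composition α.length, f.coeff [i] * ((α.splitWrtComposition c).map f.coeff).prod
      = ∑ c : Composition α.length,
          (((i :: α).splitWrtComposition (consOne i α c)).map f.coeff).prod :=
        Finset.sum_congr rfl fun c _ => (hs c).symm
    _ = ∑ d ∈ Finset.univ.image (consOne i α),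
          (((i :: α).splitWrtComposition d).map f.coeff).prod :=
        (Finset.sum_image (f := fun d => (((i :: α).splitWrtComposition d).map f.coeff).prod)
          fun _ _ _ _ h => hinj h).symm
    _ ≤ _ := Finset.sum_le_sum_of_subset_of_nonneg (Finset.subset_univ _)
        fun _ _ _ => prod_coeff_nonneg f _

theorem bCoeff_pos (f : PosRegFreeHol n) : ∀ α : List (Fin n), 0 < bCoeff f α
  | [] => by rw [bCoeff_nil]; exact one_pos
  | i :: α => lt_of_lt_of_le (mul_pos (f.coeff_letter_pos i) (bCoeff_pos f α))
      (coeff_mul_bCoeff_le f i α)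

/-- The coordinates of `W_i φ`: the coordinate of `e_{g_i α}` is `√(b_α / b_{g_i α}) φ_α`, and the
coordinates of the other basis vectors are zero. -/
def shiftFun (f : PosRegFreeHol n) (i : Fin n) (φ : List (Fin n) → ℂ) : List (Fin n) → ℂ
  | [] => 0
  | j :: α => if j = i then (Real.sqrt (bCoeff f α / bCoeff f (i :: α)) : ℂ) * φ α else 0

theorem norm_shiftFun_sq_le (f : PosRegFreeHol n) (i : Fin n) (φ : List (Fin n) → ℂ)
    (α : List (Fin n)) :
    ‖shiftFun f i φ (i :: α)‖ ^ (2 : ℝ) ≤ (f.coeff [i])⁻¹ * ‖φ α‖ ^ (2 : ℝ) := by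
  have hb := bCoeff_pos f (i :: α)
  have ha := f.coeff_letter_pos i
  have h0 : 0 ≤ bCoeff f α / bCoeff f (i :: α) := div_nonneg (bCoeff_nonneg f α) hb.le
  have h1 : bCoeff f α / bCoeff f (i :: α) ≤ (f.coeff [i])⁻¹ := by
    rw [div_le_iff₀ hb, inv_mul_eq_div, le_div_iff₀ ha, mul_comm]
    exact coeff_mul_bCoeff_le f i α
  simp only [shiftFun, if_true, norm_mul, Complex.norm_real, Real.norm_eq_abs, Real.rpow_two,
    mul_pow, sq_abs, Real.sq_sqrt h0]
  gcongr

theorem shiftFun_eq_zero (f : PosRegFreeHol n) (i : Fin n) (φ : List (Fin n) → ℂ)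
    (w : List (Fin n)) (hw : w ∉ Set.range (List.cons i)) : shiftFun f i φ w = 0 := by
  cases w with
  | nil => rfl
  | cons j α =>
    have : j ≠ i := by
      rintro rfl
      exact hw ⟨α, rfl⟩
    simp [shiftFun, this]

theorem norm_sq_summable (φ : Fock n) : Summable fun α => ‖φ α‖ ^ (2 : ℝ) := by
  simpa using (lp.memℓp φ).summable (by norm_num)

theorem shiftFun_summable (f : PosRegFreeHol n) (i : Fin n) (φ : Fock n) :
    Summable fun w => ‖shiftFun f i φ w‖ ^ (2 : ℝ) := by
  have hinj : Function.Injective (List.cons i) := fun _ _ h => (List.cons.inj h).2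
  rw [← hinj.summable_iff (f := fun w => ‖shiftFun f i φ w‖ ^ (2 : ℝ))]
  · exact Summable.of_nonneg_of_le (fun _ => Real.rpow_nonneg (norm_nonneg _) _)
      (fun α => norm_shiftFun_sq_le f i φ α) ((norm_sq_summable φ).mul_left _)
  · intro w hw
    simp [shiftFun_eq_zero f i φ w hw]

/-- The weighted left creation operator `W_i`, with `W_i e_α = √(b_α / b_{g_i α}) e_{g_i α}`. -/
def weightedShift (f : PosRegFreeHol n) (i : Fin n) : Fock n →L[ℂ] Fock n :=
  LinearMap.mkContinuous
    { toFun := fun φ => ⟨shiftFun f i φ, memℓp_gen (by simpa using shiftFun_summable f i φ)⟩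
      map_add' := by
        intro φ ψ
        ext w
        change shiftFun f i (fun α => φ α + ψ α) w = shiftFun f i φ w + shiftFun f i ψ w
        cases w with
        | nil => simp [shiftFun]
        | cons j α => by_cases h : j = i <;> simp [shiftFun, h, mul_add]
      map_smul' := by
        intro c φ
        ext w
        change shiftFun f i (fun α => c * φ α) w = c * shiftFun f i φ w
        cases w with
        | nil => simp [shiftFun]
        | cons j α => by_cases h : j = i <;> simp [shiftFun, h, mul_left_comm] }
    (Real.sqrt (f.coeff [i])⁻¹) (by
      intro φ
      have hinj : Function.Injective (List.cons i) := fun _ _ h => (List.cons.inj h).2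
      have ha : 0 ≤ (f.coeff [i])⁻¹ := inv_nonneg.2 (f.coeff_nonneg _)
      have hp : 0 < (2 : ℝ≥0∞).toReal := by norm_num
      have key : ∑' w, ‖shiftFun f i φ w‖ ^ (2 : ℝ)
          ≤ (f.coeff [i])⁻¹ * ∑' α, ‖φ α‖ ^ (2 : ℝ) := by
        rw [← tsum_mul_left, ← hinj.tsum_eq]
        · refine Summable.tsum_le_tsum (fun α => norm_shiftFun_sq_le f i φ α) ?_
            ((norm_sq_summable φ).mul_left _)
          exact (shiftFun_summable f i φ).comp_injective hinj
        · intro w hw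
          by_contra hn
          exact hw (by simp [shiftFun_eq_zero f i φ w hn])
      rw [← Real.sqrt_sq (norm_nonneg φ), ← Real.sqrt_mul ha]
      apply Real.le_sqrt_of_sq_le
      have e1 := lp.norm_rpow_eq_tsum hp φ
      have e2 := lp.norm_rpow_eq_tsum hp
        (⟨shiftFun f i φ, memℓp_gen (by simpa using shiftFun_summable f i φ)⟩ : Fock n)
      simp only [ENNReal.toReal_ofNat] at e1 e2
      simp only [LinearMap.coe_mk, AddHom.coe_mk]
      rw [← Real.rpow_two, ← Real.rpow_two, e1, e2]
      exact key)

theorem weightedShift_basisVec (f : PosRegFreeHol n) (i : Fin n) (α : List (Fin n)) :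
    weightedShift f i (basisVec α)
      = (Real.sqrt (bCoeff f α / bCoeff f (i :: α)) : ℂ) • basisVec (i :: α) := by
  ext w
  rw [lp.coeFn_smul, Pi.smul_apply]
  change shiftFun f i (basisVec α) w = _
  cases w with
  | nil => simp [shiftFun, basisVec, lp.single_apply]
  | cons j β =>
    by_cases hj : j = i
    · subst hj
      by_cases hb : β = α
      · subst hb
        simp [shiftFun, basisVec, lp.single_apply]
      · simp [shiftFun, basisVec, lp.single_apply, hb]
    · simp [shiftFun, basisVec, lp.single_apply, hj]

/-! ## The Hardy algebra, its `w*`-closed ideals, and the universal model of the variety -/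

/-- The Hardy algebra `F_n^∞(D_f)`: the bounded operators `A` on the Fock space for which there are
coefficients `c_β` with `∑ |c_β|² / b_β < ∞` and `A p = ∑_β c_β W_β p` for all polynomials `p` in
the Fock space (equivalently, for all basis vectors). -/
def hardy (f : PosRegFreeHol n) : Set (Fock n →L[ℂ] Fock n) :=
  {A | ∃ c : List (Fin n) → ℂ, Summable (fun β => ‖c β‖ ^ 2 / bCoeff f β) ∧
    ∀ γ, HasSum (fun β => c β • wordOp (weightedShift f) β (basisVec γ)) (A (basisVec γ))}

/-- The `w*`-topology (σ-weak topology) of `B(E)`: the coarsest topology for which all the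
functionals `A ↦ ∑_k ⟪x_k, A y_k⟫` with `∑ ‖x_k‖² < ∞` and `∑ ‖y_k‖² < ∞` are continuous. -/
abbrev weakStarTopology (E : Type*) [NormedAddCommGroup E] [InnerProductSpace ℂ E] :
    TopologicalSpace (E →L[ℂ] E) :=
  ⨅ (x : lp (fun _ : ℕ => E) 2) (y : lp (fun _ : ℕ => E) 2),
    TopologicalSpace.induced (fun A : E →L[ℂ] E => ∑' k, ⟪x k, A (y k)⟫_ℂ) inferInstance

/-- `J` is a `w*`-closed two-sided ideal of the Hardy algebra. -/
structure IsWeakStarClosedIdeal (f : PosRegFreeHol n)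
    (J : Submodule ℂ (Fock n →L[ℂ] Fock n)) : Prop where
  subset_hardy : (J : Set (Fock n →L[ℂ] Fock n)) ⊆ hardy f
  mul_left_mem : ∀ A ∈ hardy f, ∀ B ∈ J, A * B ∈ J
  mul_right_mem : ∀ A ∈ hardy f, ∀ B ∈ J, B * A ∈ J
  closed : IsClosed[weakStarTopology (Fock n)] (J : Set (Fock n →L[ℂ] Fock n))

/-- The `w*`-closed two-sided ideal of the Hardy algebra generated by the polynomials
`q(W_1, …, W_n)`, `q ∈ P`: the intersection of all `w*`-closed two-sided ideals containing them. -/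
def generatedIdeal (f : PosRegFreeHol n) (P : Set (FreeAlgebra ℂ (Fin n))) :
    Submodule ℂ (Fock n →L[ℂ] Fock n) :=
  sInf {J | IsWeakStarClosedIdeal f J ∧ ∀ q ∈ P, FreeAlgebra.lift ℂ (weightedShift f) q ∈ J}

/-- `M_J`, the closed linear span of `J F²(H_n)`. -/
def idealRange (J : Submodule ℂ (Fock n →L[ℂ] Fock n)) : Submodule ℂ (Fock n) :=
  (Submodule.span ℂ {x | ∃ A ∈ J, ∃ φ : Fock n, A φ = x}).topologicalClosure

/-- `N_J = F²(H_n) ⊖ M_J`. -/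
abbrev modelSpace (J : Submodule ℂ (Fock n →L[ℂ] Fock n)) : Submodule ℂ (Fock n) :=
  (idealRange J)ᗮ

/-- The universal model `B_i = P_{N_J} W_i |_{N_J}` of the variety. -/
def modelOp (f : PosRegFreeHol n) (J : Submodule ℂ (Fock n →L[ℂ] Fock n)) (i : Fin n) :
    modelSpace J →L[ℂ] modelSpace J :=
  (modelSpace J).orthogonalProjectionOnto ∘L weightedShift f i ∘L (modelSpace J).subtypeL

end Model

/-! ## Hilbert space tensor products and direct sums -/

section Constructions

variable (E F : Type*) [NormedAddCommGroup E] [InnerProductSpace ℂ E]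
  [NormedAddCommGroup F] [InnerProductSpace ℂ F]

/-- The Hilbert space tensor product: the completion of the algebraic tensor product. -/
abbrev HilbertTensor : Type _ := UniformSpace.Completion (E ⊗[ℂ] F)

/-- The Hilbert space direct sum. -/
abbrev HilbertSum : Type _ := WithLp 2 (E × F)

variable {E F}

/-- The bounded operator `A ⊗ I_F` on the Hilbert space tensor product. -/
def ampliate (A : E →L[ℂ] E) : HilbertTensor E F →L[ℂ] HilbertTensor E F :=
  (A.rTensor F).completion

theorem ampliate_tmul (A : E →L[ℂ] E) (x : E) (y : F) :
    ampliate A ((x ⊗ₜ[ℂ] y : E ⊗[ℂ] F) : HilbertTensor E F)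
      = ((A x ⊗ₜ[ℂ] y : E ⊗[ℂ] F) : HilbertTensor E F) := by
  simp [ampliate]

/-- The operator with block matrix `[[A, 0], [0, B]]` on the Hilbert space direct sum. -/
def blockDiag (A : E →L[ℂ] E) (B : F →L[ℂ] F) : HilbertSum E F →L[ℂ] HilbertSum E F :=
  (WithLp.prodContinuousLinearEquiv 2 ℂ E F).symm.toContinuousLinearMap ∘L
    (A.prodMap B) ∘L (WithLp.prodContinuousLinearEquiv 2 ℂ E F).toContinuousLinearMap

end Constructions

end NCVariety

end

universe u

open NCVariety

namespace NCVariety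

/-! ## The recursion for the coefficients `b_α` -/

/-! The dilation is the pair (Poisson kernel, square root of its defect). Write `Δ` for the defect
operator of `T` and `p(x) = ∑ b_α ‖Δ T_α* x‖²` (`poissonForm`). Cutting off the first factor of a
factorization gives `b_δ = ∑_{γα=δ} a_γ b_α` for `δ ≠ ∅`, hence `p(x) = ‖Δx‖² + ∑ a_γ p(T_γ* x)`.
The squared norm satisfies the same equation, `‖x‖² = ‖Δx‖² + ∑ a_γ ‖T_γ* x‖²`, and induction on
word length gives `p(x) ≤ ‖x‖²`. So the Poisson kernel `K x = (√b_α Δ T_α* x)_α` is a contraction.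

Let `R = (I - K*K)^{1/2}`. Subtracting the two equations yields `∑ a_α ‖R T_α* x‖² = ‖R x‖²`.
Therefore `R x ↦ R T_i* x` extends to the closure of the range of `R`; the adjoints of these
extensions form `U`, and the identity becomes `∑ a_α U_α U_α* = I` (`exists_residual`). The map `x ↦
(K x, R x)` is the required isometry.

It remains to see that `K` lands in `N_J ⊗ D`, with `D` the defect space. Since `K*` intertwines
`W_i ⊗ I` with `T_i`, it kills every `p(W) q(W) e_γ ⊗ y` with `q` a generator. That these vectors
suffice is `idealRange_generatedIdeal_le`: the Hardy algebra is the commutant of the right shifts,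
hence `w*`-closed, and its elements with range in the closed span of the `p(W) q(W) e_γ` form a
`w*`-closed ideal containing the generators. No functional calculus for `T` is needed.

For purity: `‖R x‖²` is fixed by `Φ` and at most `‖x‖²`, so it is below every `⟪Φ^m(I) x, x⟫`.
Conversely, if `R = 0`, these forms are bounded by the tails of the convergent series `p(x)`
(`isPure_iff_residual`). -/

/-- Splits off the first block, of size `k + 1`. The summand depends only on the list of blocks,
which avoids transport between the types `Composition N`. -/
theorem sum_composition_succ {M : Type*} [AddCommMonoid M] (m : ℕ) (g : List ℕ → M) :
    ∑ c : Composition (m + 1), g c.blocks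
      = ∑ k ∈ Finset.range (m + 1), ∑ c : Composition (m - k), g ((k + 1) :: c.blocks) := by
  rw [Finset.sum_sigma']
  symm
  refine Finset.sum_bij (fun x hx => (⟨(x.1 + 1) :: x.2.blocks, ?_, ?_⟩ : Composition (m + 1)))
    ?_ ?_ ?_ ?_
  · intro i hi
    rcases List.mem_cons.1 hi with rfl | hi
    · omega
    · exact x.2.blocks_pos hi
  · have := x.2.blocks_sum
    simp only [Finset.mem_sigma, Finset.mem_range] at hx
    simp only [List.sum_cons]
    omega
  · simp
  · rintro ⟨k, c⟩ _ ⟨l, d⟩ _ h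
    have h' := congrArg Composition.blocks h
    simp only [List.cons.injEq, Nat.add_right_cancel_iff] at h'
    obtain ⟨rfl, h2⟩ := h'
    obtain rfl := Composition.ext h2
    rfl
  · intro c _
    obtain ⟨blocks, hpos, hsum⟩ := c
    cases blocks with
    | nil => simp at hsum
    | cons k bs =>
      have hk : 0 < k := hpos List.mem_cons_self
      rw [List.sum_cons] at hsum
      refine ⟨⟨k - 1, ⟨bs, fun h => hpos (List.mem_cons_of_mem _ h), by omega⟩⟩, ?_, ?_⟩
      · simp only [Finset.mem_sigma, Finset.mem_range, Finset.mem_univ, and_true]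
        omega
      · apply Composition.ext
        simp only [List.cons.injEq, and_true]
        omega
  · intro _ _
    rfl

variable {n : ℕ}

/-- Makes the length a free variable, so that the recursion can be applied to suffixes without
casts. -/
theorem bCoeff_eq_sum (f : PosRegFreeHol n) (α : List (Fin n)) {N : ℕ} (h : α.length = N) :
    bCoeff f α
      = ∑ c : Composition N, ((α.splitWrtCompositionAux c.blocks).map f.coeff).prod := by
  subst h
  rfl

theorem bCoeff_eq_sum_take_drop (f : PosRegFreeHol n) (α : List (Fin n)) (h : α ≠ []) :
    bCoeff f α
      = ∑ k ∈ Finset.range α.length, f.coeff (α.take (k + 1)) * bCoeff f (α.drop (k + 1)) := by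
  obtain ⟨m, hm⟩ : ∃ m, α.length = m + 1 :=
    Nat.exists_eq_succ_of_ne_zero (by simpa using h)
  rw [bCoeff_eq_sum f α hm, sum_composition_succ m fun bs =>
    ((α.splitWrtCompositionAux bs).map f.coeff).prod, hm]
  refine Finset.sum_congr rfl fun k _ => ?_
  rw [bCoeff_eq_sum f (α.drop (k + 1)) (N := m - k) (by rw [List.length_drop]; omega),
    Finset.mul_sum]
  simp [List.splitWrtCompositionAux_cons]

theorem sum_coeff_take_mul_bCoeff_drop (f : PosRegFreeHol n) (α : List (Fin n)) :
    ∑ k : Fin (α.length + 1), f.coeff (α.take k) * bCoeff f (α.drop k)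
      = if α = [] then 0 else bCoeff f α := by
  rw [Fin.sum_univ_eq_sum_range (fun k => f.coeff (α.take k) * bCoeff f (α.drop k)),
    Finset.sum_range_succ']
  simp only [List.take_zero, f.coeff_nil, zero_mul, add_zero]
  split_ifs with h
  · simp [h]
  · exact (bCoeff_eq_sum_take_drop f α h).symm

/-- The recursion strips factors on the left, so a letter added on the right survives in the suffix
and induction on the length applies. The term in which the whole word is one factor is discarded.
This bounds the right shifts. -/
theorem bCoeff_mul_coeff_le (f : PosRegFreeHol n) (i : Fin n) (α : List (Fin n)) :
    f.coeff [i] * bCoeff f α ≤ bCoeff f (α ++ [i]) := by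
  induction hN : α.length using Nat.strong_induction_on generalizing α with
  | _ N ih =>
    rcases eq_or_ne α [] with rfl | hα
    · simpa using coeff_mul_bCoeff_le f i []
    · rw [bCoeff_eq_sum_take_drop f α hα, bCoeff_eq_sum_take_drop f (α ++ [i]) (by simp),
        List.length_append, List.length_singleton, Finset.sum_range_succ, Finset.mul_sum]
      refine le_add_of_le_of_nonneg (Finset.sum_le_sum fun k hk => ?_)
        (mul_nonneg (f.coeff_nonneg _) (bCoeff_nonneg f _))
      have hk' := Finset.mem_range.1 hk
      rw [List.take_append_of_le_length (by omega), List.drop_append_of_le_length (by omega),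
        mul_left_comm]
      exact mul_le_mul_of_nonneg_left
        (ih _ (by rw [← hN, List.length_drop]; omega) _ rfl) (f.coeff_nonneg _)

/-- Pairs of words correspond to words with a cutting position. -/
def splitEquiv (A : Type*) : List A × List A ≃ Σ α : List A, Fin (α.length + 1) where
  toFun p := ⟨p.1 ++ p.2, ⟨p.1.length, by simp⟩⟩
  invFun q := (q.1.take q.2, q.1.drop q.2)
  left_inv p := by simp
  right_inv q := by
    obtain ⟨α, k, hk⟩ := q
    refine Sigma.ext (List.take_append_drop k α) ?_
    refine (Fin.heq_ext_iff (by simp)).2 ?_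
    simp
    omega

/-- The identity `∑_{γ, α} a_γ b_α F(γα) = ∑_{δ ≠ ∅} b_δ F(δ)`. -/
theorem tsum_coeff_mul_bCoeff (f : PosRegFreeHol n) (F : List (Fin n) → ℝ≥0∞) :
    ∑' γ, ∑' α, ENNReal.ofReal (f.coeff γ) * (ENNReal.ofReal (bCoeff f α) * F (γ ++ α))
      = ∑' δ, (if δ = [] then 0 else ENNReal.ofReal (bCoeff f δ)) * F δ := by
  rw [← ENNReal.tsum_prod, ← (splitEquiv (Fin n)).symm.tsum_eq, ENNReal.tsum_sigma']
  refine tsum_congr fun δ => ?_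
  have h1 : (if δ = [] then 0 else ENNReal.ofReal (bCoeff f δ))
      = ∑ k : Fin (δ.length + 1),
        ENNReal.ofReal (f.coeff (δ.take k)) * ENNReal.ofReal (bCoeff f (δ.drop k)) := by
    rw [← ENNReal.ofReal_zero, ← apply_ite ENNReal.ofReal, ← sum_coeff_take_mul_bCoeff_drop,
      ENNReal.ofReal_sum_of_nonneg
        fun k _ => mul_nonneg (f.coeff_nonneg _) (bCoeff_nonneg f _)]
    exact Finset.sum_congr rfl fun k _ => ENNReal.ofReal_mul (f.coeff_nonneg _)
  rw [tsum_fintype, h1, Finset.sum_mul]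
  refine Finset.sum_congr rfl fun k _ => ?_
  simp [splitEquiv, mul_assoc]

/-! ## Operators into spaces of square summable families -/

section SquareSummable

variable {ι E G : Type*} [NormedAddCommGroup E] [NormedAddCommGroup G]

theorem enorm_sq_eq_ofReal (x : E) : ‖x‖ₑ ^ 2 = ENNReal.ofReal (‖x‖ ^ 2) := by
  rw [← ofReal_norm, ENNReal.ofReal_pow (norm_nonneg x)]

/-- Squared norms are handled in `ℝ≥0∞`, where series can be rearranged without summability
conditions. -/
theorem lp_enorm_sq (φ : lp (fun _ : ι => E) 2) : ‖φ‖ₑ ^ 2 = ∑' i, ‖φ i‖ₑ ^ 2 := by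
  have h := lp.hasSum_norm (p := 2) (by norm_num) φ
  simp only [ENNReal.toReal_ofNat, Real.rpow_two] at h
  rw [enorm_sq_eq_ofReal, ← h.tsum_eq,
    ENNReal.ofReal_tsum_of_nonneg (fun _ => sq_nonneg _) h.summable]
  simp only [enorm_sq_eq_ofReal]

theorem enorm_sq_le_iff {x : E} {y : G} : ‖x‖ₑ ^ 2 ≤ ‖y‖ₑ ^ 2 ↔ ‖x‖ ≤ ‖y‖ := by
  rw [ENNReal.pow_le_pow_left_iff two_ne_zero, enorm_le_iff_norm_le]

theorem enorm_sq_eq_iff {x : E} {y : G} : ‖x‖ₑ ^ 2 = ‖y‖ₑ ^ 2 ↔ ‖x‖ = ‖y‖ := by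
  rw [le_antisymm_iff, le_antisymm_iff, enorm_sq_le_iff, enorm_sq_le_iff]

theorem memℓp_two_of_tsum_ne_top {v : ι → E} (h : ∑' i, ‖v i‖ₑ ^ 2 ≠ ∞) : Memℓp v 2 := by
  apply memℓp_gen
  have := ENNReal.summable_toReal h
  simpa using this

variable [InnerProductSpace ℂ E] [InnerProductSpace ℂ G]

/-- A square summable family of operators defines an operator into the `ℓ²`-space. -/
theorem exists_toLp_of_tsum_le (S : ι → G →L[ℂ] E) (C : NNReal)
    (hS : ∀ x, ∑' i, ‖S i x‖ₑ ^ 2 ≤ C * ‖x‖ₑ ^ 2) :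
    ∃ V : G →L[ℂ] lp (fun _ : ι => E) 2, ∀ x i, V x i = S i x := by
  have hmem : ∀ x, Memℓp (fun i => S i x) 2 := fun x =>
    memℓp_two_of_tsum_ne_top
      (ne_top_of_le_ne_top (ENNReal.mul_ne_top ENNReal.coe_ne_top (by simp)) (hS x))
  refine ⟨LinearMap.mkContinuous
    { toFun := fun x => ⟨fun i => S i x, hmem x⟩
      map_add' := fun x y => by ext i; exact map_add (S i) x y
      map_smul' := fun c x => by ext i; exact map_smul (S i) c x } (NNReal.sqrt C) ?_, fun _ _ => rfl⟩
  intro x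
  -- Writing the bound as the square of the norm of `√C • x` lets `enorm_sq_le_iff` take the root.
  have h : ‖(⟨fun i => S i x, hmem x⟩ : lp (fun _ : ι => E) 2)‖ₑ ^ 2
      ≤ ‖(NNReal.sqrt C : ℂ) • x‖ₑ ^ 2 := by
    rw [lp_enorm_sq, enorm_smul, mul_pow]
    refine (hS x).trans_eq ?_
    congr 1
    rw [enorm_sq_eq_ofReal, Complex.norm_real, NNReal.norm_eq, ← NNReal.coe_pow, NNReal.sq_sqrt,
      ENNReal.ofReal_coe_nnreal]
  rw [enorm_sq_le_iff, norm_smul, Complex.norm_real, NNReal.norm_eq] at h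
  exact h

end SquareSummable

section

variable {n : ℕ} {H : Type*} [NormedAddCommGroup H] [InnerProductSpace ℂ H] [CompleteSpace H]
  {G : Type*} [NormedAddCommGroup G] [InnerProductSpace ℂ G] [CompleteSpace G]

open ContinuousLinearMap (adjoint)

/-! ## Square roots of contractions -/

theorem enorm_sq_add_of_norm_sq_add {E F L : Type*} [NormedAddCommGroup E] [NormedAddCommGroup F]
    [NormedAddCommGroup L] {x : E} {y : F} {z : L} (h : ‖x‖ ^ 2 + ‖y‖ ^ 2 = ‖z‖ ^ 2) :
    ‖x‖ₑ ^ 2 + ‖y‖ₑ ^ 2 = ‖z‖ₑ ^ 2 := by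
  rw [enorm_sq_eq_ofReal, enorm_sq_eq_ofReal, enorm_sq_eq_ofReal, ← h,
    ENNReal.ofReal_add (sq_nonneg _) (sq_nonneg _)]

theorem adjoint_sqrt_comp_sqrt {Y : H →L[ℂ] H} (hY : 0 ≤ Y) :
    adjoint (CFC.sqrt Y) ∘L CFC.sqrt Y = Y := by
  have h1 : IsSelfAdjoint (CFC.sqrt Y) := (CFC.sqrt_nonneg Y).isSelfAdjoint
  rw [ContinuousLinearMap.isSelfAdjoint_iff'.1 h1]
  exact CFC.sqrt_mul_sqrt_self Y hY

theorem norm_sq_eq_re_inner_adjoint_comp (S : H →L[ℂ] G) (x : H) :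
    ‖S x‖ ^ 2 = RCLike.re ⟪(adjoint S ∘L S) x, x⟫_ℂ :=
  ContinuousLinearMap.apply_norm_sq_eq_inner_adjoint_left S x

/-- Brings a quadratic form given by an operator into another space back to an operator on `H`, as
iterating `Φ` requires. -/
theorem norm_sqrt_adjoint_comp (V : H →L[ℂ] G) (x : H) :
    ‖CFC.sqrt (adjoint V ∘L V) x‖ = ‖V x‖ := by
  have h : 0 ≤ adjoint V ∘L V := by
    rw [ContinuousLinearMap.nonneg_iff_isPositive]
    exact ContinuousLinearMap.isPositive_adjoint_comp_self V
  have h1 := norm_sq_eq_re_inner_adjoint_comp (CFC.sqrt (adjoint V ∘L V)) x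
  rw [adjoint_sqrt_comp_sqrt h, ← norm_sq_eq_re_inner_adjoint_comp] at h1
  exact (pow_left_inj₀ (norm_nonneg _) (norm_nonneg _) two_ne_zero).1 h1

/-- Used twice: for the defect operator of `X`, and for the residual of the Poisson kernel. -/
theorem norm_sq_sqrt_one_sub (V : H →L[ℂ] G) (hV : ∀ x, ‖V x‖ₑ ^ 2 ≤ ‖x‖ₑ ^ 2) (x : H) :
    ‖CFC.sqrt (1 - adjoint V ∘L V) x‖ ^ 2 + ‖V x‖ ^ 2 = ‖x‖ ^ 2 := by
  have key : ∀ x, RCLike.re ⟪(1 - adjoint V ∘L V) x, x⟫_ℂ = ‖x‖ ^ 2 - ‖V x‖ ^ 2 := by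
    intro x
    rw [norm_sq_eq_re_inner_adjoint_comp V x, sub_apply, inner_sub_left,
      map_sub, one_apply_eq_self, inner_self_eq_norm_sq]
  have h : 0 ≤ 1 - adjoint V ∘L V := by
    rw [ContinuousLinearMap.nonneg_iff_isPositive, ContinuousLinearMap.isPositive_def']
    refine ⟨(IsSelfAdjoint.one _).sub
      (ContinuousLinearMap.isPositive_adjoint_comp_self V).isSelfAdjoint, fun x => ?_⟩
    have := enorm_sq_le_iff.1 (hV x)
    rw [ContinuousLinearMap.reApplyInnerSelf_apply, key]
    nlinarith [norm_nonneg (V x)]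
  rw [norm_sq_eq_re_inner_adjoint_comp (CFC.sqrt _) x, adjoint_sqrt_comp_sqrt h, key]
  ring

/-! ## The completely positive map `Φ_{f,X}` -/

omit [CompleteSpace H] in
theorem wordOp_append (X : Fin n → H →L[ℂ] H) (α β : List (Fin n)) :
    wordOp X (α ++ β) = wordOp X α ∘L wordOp X β := by
  simp only [wordOp, List.map_append, List.prod_append]
  rfl

omit [CompleteSpace H] in
theorem wordOp_cons (X : Fin n → H →L[ℂ] H) (i : Fin n) (α : List (Fin n)) :
    wordOp X (i :: α) = X i ∘L wordOp X α := by
  simp only [wordOp, List.map_cons, List.prod_cons]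
  rfl

omit [CompleteSpace H] in
theorem wordOp_nil (X : Fin n → H →L[ℂ] H) : wordOp X [] = 1 := rfl

omit [CompleteSpace H] in
theorem wordOp_singleton (X : Fin n → H →L[ℂ] H) (i : Fin n) : wordOp X [i] = X i := by
  simp [wordOp]

theorem adjoint_wordOp_append (X : Fin n → H →L[ℂ] H) (α β : List (Fin n)) (x : H) :
    adjoint (wordOp X (α ++ β)) x = adjoint (wordOp X β) (adjoint (wordOp X α) x) := by
  rw [wordOp_append, ContinuousLinearMap.adjoint_comp]
  rfl

theorem adjoint_wordOp_nil (X : Fin n → H →L[ℂ] H) (x : H) : adjoint (wordOp X []) x = x := by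
  rw [wordOp_nil, ← ContinuousLinearMap.star_eq_adjoint, star_one]
  rfl

theorem inner_phiTerm (f : PosRegFreeHol n) (X : Fin n → H →L[ℂ] H) (S : H →L[ℂ] G)
    (α : List (Fin n)) (x y : H) :
    ⟪y, phiTerm f X (adjoint S ∘L S) α x⟫_ℂ
      = (f.coeff α : ℂ) * ⟪S (adjoint (wordOp X α) y), S (adjoint (wordOp X α) x)⟫_ℂ := by
  change ⟪y, (f.coeff α : ℂ) • wordOp X α (adjoint S (S (adjoint (wordOp X α) x)))⟫_ℂ = _
  rw [inner_smul_right, ← ContinuousLinearMap.adjoint_inner_left,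
    ContinuousLinearMap.adjoint_inner_right]

/-- The functional `A ↦ ⟪y, A x⟫`. -/
noncomputable def wotInner (x y : H) : (H →WOT[ℂ] H) →+ ℂ where
  toFun A := ⟪y, A x⟫_ℂ
  map_zero' := inner_zero_right y
  map_add' A B := inner_add_right y (A x) (B x)

omit [CompleteSpace H] in
theorem continuous_wotInner (x y : H) : Continuous (wotInner x y) :=
  ContinuousLinearMapWOT.continuous_dual_apply x (innerSL ℂ y)

theorem hasSum_wot_iff {ι : Type*} {A : ι → H →WOT[ℂ] H} {B : H →WOT[ℂ] H} :
    HasSum A B ↔ ∀ x y, HasSum (fun i => ⟪y, A i x⟫_ℂ) ⟪y, B x⟫_ℂ := by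
  refine ⟨fun h x y => h.map (wotInner x y) (continuous_wotInner x y), fun h => ?_⟩
  refine ContinuousLinearMapWOT.tendsto_iff_forall_inner_apply_tendsto.2 fun x y => ?_
  have h' := h x y
  rw [HasSum] at h'
  convert h' using 2 with s
  exact map_sum (wotInner x y) A s

/-- If `∑ a_α ‖S X_α* x‖² ≤ C ‖x‖²`, then `Φ_{f,X}(S* S)` converges, and it is `V* V` with
`‖V x‖² = ∑ a_α ‖S X_α* x‖²`. -/
theorem exists_hasSum_phiTerm (f : PosRegFreeHol n) (X : Fin n → H →L[ℂ] H) (S : H →L[ℂ] G)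
    (C : NNReal) (hS : ∀ x, ∑' α, ENNReal.ofReal (f.coeff α) * ‖S (adjoint (wordOp X α) x)‖ₑ ^ 2
      ≤ C * ‖x‖ₑ ^ 2) :
    ∃ V : H →L[ℂ] lp (fun _ : List (Fin n) => G) 2,
      (∀ x, ‖V x‖ₑ ^ 2
        = ∑' α, ENNReal.ofReal (f.coeff α) * ‖S (adjoint (wordOp X α) x)‖ₑ ^ 2) ∧
      HasSum (phiTerm f X (adjoint S ∘L S)) (ContinuousLinearMapWOT.ofCLM (adjoint V ∘L V)) := by
  have hterm : ∀ α x, ‖((√(f.coeff α) : ℂ) • (S ∘L adjoint (wordOp X α))) x‖ₑ ^ 2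
      = ENNReal.ofReal (f.coeff α) * ‖S (adjoint (wordOp X α) x)‖ₑ ^ 2 := by
    intro α x
    rw [smul_apply, enorm_smul, mul_pow, enorm_sq_eq_ofReal,
      Complex.norm_real, Real.norm_eq_abs, sq_abs, Real.sq_sqrt (f.coeff_nonneg α)]
    rfl
  obtain ⟨V, hV⟩ := exists_toLp_of_tsum_le
    (fun α => (√(f.coeff α) : ℂ) • (S ∘L adjoint (wordOp X α))) C (by simpa only [hterm] using hS)
  refine ⟨V, fun x => by simp only [lp_enorm_sq, hV, hterm], ?_⟩
  refine hasSum_wot_iff.2 fun x y => ?_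
  -- Weak convergence is the expansion of the `ℓ²` inner product `⟪V y, V x⟫ = ⟪y, V* V x⟫`.
  have h := lp.hasSum_inner (𝕜 := ℂ) (V y) (V x)
  rw [← ContinuousLinearMap.adjoint_inner_right] at h
  refine h.congr_fun fun α => ?_
  rw [inner_phiTerm, hV, hV, smul_apply, smul_apply, inner_smul_left, inner_smul_right,
    ← mul_assoc, Complex.conj_ofReal, ← Complex.ofReal_mul, Real.mul_self_sqrt (f.coeff_nonneg α)]
  rfl

/-- On the diagonal the weakly convergent series has nonnegative terms, and its sum `⟪x, Φ(I) x⟫` is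
at most `‖x‖²`. -/
theorem tsum_coeff_le_of_mem_domain {f : PosRegFreeHol n} {X : Fin n → H →L[ℂ] H}
    (hX : X ∈ domain H f) (x : H) :
    ∑' α, ENNReal.ofReal (f.coeff α) * ‖adjoint (wordOp X α) x‖ₑ ^ 2 ≤ ‖x‖ₑ ^ 2 := by
  obtain ⟨hs, hn⟩ := hX
  have h := hasSum_wot_iff.1 hs.hasSum x x
  have h1 : ∀ α, ⟪x, phiTerm f X 1 α x⟫_ℂ
      = ((f.coeff α * ‖adjoint (wordOp X α) x‖ ^ 2 : ℝ) : ℂ) := by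
    intro α
    have := inner_phiTerm f X (1 : H →L[ℂ] H) α x x
    rw [← ContinuousLinearMap.star_eq_adjoint, star_one] at this
    refine Eq.trans this ?_
    simp only [one_apply_eq_self, inner_self_eq_norm_sq_to_K]
    push_cast
    rfl
  simp only [h1] at h
  have h2 := Complex.hasSum_re h
  simp only [Complex.ofReal_re] at h2
  simp only [enorm_sq_eq_ofReal, ← ENNReal.ofReal_mul (f.coeff_nonneg _)]
  rw [← ENNReal.ofReal_tsum_of_nonneg
    (fun α => mul_nonneg (f.coeff_nonneg α) (sq_nonneg _)) h2.summable, h2.tsum_eq]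
  apply ENNReal.ofReal_le_ofReal
  calc (⟪x, phi f X 1 x⟫_ℂ).re ≤ ‖x‖ * ‖phi f X 1 x‖ := re_inner_le_norm (𝕜 := ℂ) _ _
    _ ≤ ‖x‖ * (1 * ‖x‖) := by
      gcongr
      exact (phi f X 1).le_of_opNorm_le hn x
    _ = ‖x‖ ^ 2 := by ring

/-- A tuple `X` is contractive for `f` when `∑ a_α ‖X_α* x‖² ≤ ‖x‖²` for all `x`. -/
def IsContractiveFor (f : PosRegFreeHol n) (X : Fin n → H →L[ℂ] H) : Prop :=
  ∀ x : H, ∑' α, ENNReal.ofReal (f.coeff α) * ‖adjoint (wordOp X α) x‖ₑ ^ 2 ≤ ‖x‖ₑ ^ 2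

/-- The bound `‖S X_α* x‖ ≤ ‖S‖ ‖X_α* x‖` gives convergence, so that `phi` is the genuine sum and
not the default value of `tsum`. -/
theorem IsContractiveFor.exists_phi_eq {f : PosRegFreeHol n} {X : Fin n → H →L[ℂ] H}
    (hX : IsContractiveFor f X) (S : H →L[ℂ] G) :
    Summable (phiTerm f X (adjoint S ∘L S)) ∧
    ∃ V : H →L[ℂ] lp (fun _ : List (Fin n) => G) 2,
      phi f X (adjoint S ∘L S) = adjoint V ∘L V ∧
      ∀ x, ‖V x‖ₑ ^ 2
        = ∑' α, ENNReal.ofReal (f.coeff α) * ‖S (adjoint (wordOp X α) x)‖ₑ ^ 2 := by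
  obtain ⟨V, hV, hs⟩ := exists_hasSum_phiTerm f X S (‖S‖₊ ^ 2) fun x => by
    calc ∑' α, ENNReal.ofReal (f.coeff α) * ‖S (adjoint (wordOp X α) x)‖ₑ ^ 2
        ≤ ∑' α, ‖S‖ₑ ^ 2 * (ENNReal.ofReal (f.coeff α) * ‖adjoint (wordOp X α) x‖ₑ ^ 2) := by
          refine ENNReal.tsum_le_tsum fun α => ?_
          rw [mul_left_comm, ← mul_pow]
          gcongr
          exact S.le_opENorm _
      _ ≤ ‖S‖ₑ ^ 2 * ‖x‖ₑ ^ 2 := by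
          rw [ENNReal.tsum_mul_left]
          gcongr
          exact hX x
      _ = _ := by simp [enorm_eq_nnnorm]
  refine ⟨hs.summable, V, ?_, hV⟩
  rw [phi, hs.tsum_eq]

theorem adjoint_one_comp_one : adjoint (1 : H →L[ℂ] H) ∘L (1 : H →L[ℂ] H) = 1 := by
  rw [← ContinuousLinearMap.star_eq_adjoint, star_one]
  rfl

theorem IsContractiveFor.mem_domain {f : PosRegFreeHol n} {X : Fin n → H →L[ℂ] H}
    (hX : IsContractiveFor f X)
    (hX1 : ∀ x, ∑' α, ENNReal.ofReal (f.coeff α) * ‖adjoint (wordOp X α) x‖ₑ ^ 2 = ‖x‖ₑ ^ 2) :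
    X ∈ domain H f ∧ phi f X 1 = 1 := by
  obtain ⟨hs, V, hV, hn⟩ := hX.exists_phi_eq (1 : H →L[ℂ] H)
  rw [adjoint_one_comp_one] at hs hV
  have h1 : phi f X 1 = 1 := by
    rw [hV]
    refine (ContinuousLinearMap.norm_map_iff_adjoint_comp_self V).1 fun x => ?_
    exact enorm_sq_eq_iff.1 ((hn x).trans (hX1 x))
  refine ⟨⟨hs, ?_⟩, h1⟩
  rw [h1]
  -- An inequality, since the space may be zero.
  exact ContinuousLinearMap.norm_id_le

theorem IsContractiveFor.defect_add {f : PosRegFreeHol n} {X : Fin n → H →L[ℂ] H}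
    (hX : IsContractiveFor f X) (x : H) :
    ‖defect f X x‖ₑ ^ 2 + ∑' α, ENNReal.ofReal (f.coeff α) * ‖adjoint (wordOp X α) x‖ₑ ^ 2
      = ‖x‖ₑ ^ 2 := by
  obtain ⟨-, V, hV, hn⟩ := hX.exists_phi_eq (1 : H →L[ℂ] H)
  rw [adjoint_one_comp_one] at hV
  simp only [one_apply_eq_self] at hn
  rw [defect, hV, ← hn x]
  exact enorm_sq_add_of_norm_sq_add (norm_sq_sqrt_one_sub V (fun x => (hn x).trans_le (hX x)) x)

/-! ## Iterates of `Φ_{f,X}` and purity -/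

/-- The quadratic form `⟪Φ_{f,X}^m(I) x, x⟫`. -/
noncomputable def phiForm (f : PosRegFreeHol n) (X : Fin n → H →L[ℂ] H) : ℕ → H → ℝ≥0∞
  | 0, x => ‖x‖ₑ ^ 2
  | m + 1, x => ∑' α, ENNReal.ofReal (f.coeff α) * phiForm f X m (adjoint (wordOp X α) x)

theorem IsContractiveFor.phiForm_le {f : PosRegFreeHol n} {X : Fin n → H →L[ℂ] H}
    (hX : IsContractiveFor f X) (m : ℕ) (x : H) : phiForm f X m x ≤ ‖x‖ₑ ^ 2 := by
  induction m generalizing x with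
  | zero => exact le_rfl
  | succ m ih =>
    refine le_trans (ENNReal.tsum_le_tsum fun α => ?_) (hX x)
    gcongr
    exact ih _

/-- The form `S* S` is what `exists_phi_eq` accepts, so it is restored after each step by taking a
square root. -/
theorem IsContractiveFor.exists_iterate_eq {f : PosRegFreeHol n} {X : Fin n → H →L[ℂ] H}
    (hX : IsContractiveFor f X) (m : ℕ) :
    ∃ S : H →L[ℂ] H, (phi f X)^[m] 1 = adjoint S ∘L S ∧ ∀ x, ‖S x‖ₑ ^ 2 = phiForm f X m x := by
  induction m with
  | zero => exact ⟨1, adjoint_one_comp_one.symm, fun x => rfl⟩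
  | succ m ih =>
    obtain ⟨S, hS, hn⟩ := ih
    obtain ⟨-, V, hV, hVn⟩ := hX.exists_phi_eq S
    have hpos : 0 ≤ adjoint V ∘L V := by
      rw [ContinuousLinearMap.nonneg_iff_isPositive]
      exact ContinuousLinearMap.isPositive_adjoint_comp_self V
    refine ⟨CFC.sqrt (adjoint V ∘L V), ?_, fun x => ?_⟩
    · rw [Function.iterate_succ_apply', hS, hV, adjoint_sqrt_comp_sqrt hpos]
    · rw [enorm_sq_eq_iff.2 (norm_sqrt_adjoint_comp V x), hVn]
      simp only [hn, phiForm]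

/-- For positive contractions `S* S`, strong and weak convergence to zero agree: `‖S x‖² ≤ ‖S* S x‖
‖x‖` and `‖S* S x‖ ≤ ‖S x‖`. -/
theorem IsContractiveFor.isPure_iff {f : PosRegFreeHol n} {X : Fin n → H →L[ℂ] H}
    (hX : IsContractiveFor f X) :
    IsPure f X ↔ ∀ x, Tendsto (fun m => phiForm f X m x) atTop (𝓝 0) := by
  choose S hS hn using hX.exists_iterate_eq
  constructor
  · intro h x
    have h1 : Tendsto (fun m => ‖(phi f X)^[m] 1 x‖ₑ * ‖x‖ₑ) atTop (𝓝 0) := by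
      have := ENNReal.Tendsto.mul_const (b := ‖x‖ₑ) (h x).enorm (Or.inr enorm_ne_top)
      simpa using this
    refine tendsto_of_tendsto_of_tendsto_of_le_of_le tendsto_const_nhds h1
      (fun m => zero_le) fun m => ?_
    dsimp only
    rw [← hn, enorm_sq_eq_ofReal, ← ofReal_norm, ← ofReal_norm,
      ← ENNReal.ofReal_mul (norm_nonneg _), norm_sq_eq_re_inner_adjoint_comp, hS m]
    exact ENNReal.ofReal_le_ofReal (re_inner_le_norm _ _)
  · intro h x
    have hle : ∀ m y, ‖S m y‖ ≤ ‖y‖ := fun m y =>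
      enorm_sq_le_iff.1 ((hn m y).trans_le (hX.phiForm_le m y))
    have h1 : Tendsto (fun m => ‖S m x‖) atTop (𝓝 0) := by
      have h2 := (ENNReal.tendsto_toReal ENNReal.zero_ne_top).comp (h x)
      have h3 : Tendsto (fun m => √(phiForm f X m x).toReal) atTop (𝓝 0) := by
        have := h2.sqrt
        simpa [Function.comp_def] using this
      refine h3.congr fun m => ?_
      rw [← hn, ENNReal.toReal_pow, toReal_enorm, Real.sqrt_sq (norm_nonneg _)]
    refine squeeze_zero_norm (fun m => ?_) h1
    rw [hS m]
    calc ‖adjoint (S m) (S m x)‖ ≤ ‖adjoint (S m)‖ * ‖S m x‖ :=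
          ContinuousLinearMap.le_opNorm _ _
      _ ≤ 1 * ‖S m x‖ := by
          gcongr
          rw [LinearIsometryEquiv.norm_map]
          exact ContinuousLinearMap.opNorm_le_bound _ zero_le_one fun y => by
            rw [one_mul]
            exact hle m y
      _ = _ := one_mul _

/-! ## The quadratic form of the Poisson kernel -/

/-- `∑ b_α ‖Δ X_α* x‖²`, the squared norm of the Poisson kernel at `x`. -/
noncomputable def poissonForm (f : PosRegFreeHol n) (X : Fin n → H →L[ℂ] H) (x : H) : ℝ≥0∞ :=
  ∑' α, ENNReal.ofReal (bCoeff f α) * ‖defect f X (adjoint (wordOp X α) x)‖ₑ ^ 2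

theorem tsum_bCoeff_eq (f : PosRegFreeHol n) (F : List (Fin n) → ℝ≥0∞) :
    ∑' δ, ENNReal.ofReal (bCoeff f δ) * F δ
      = F [] + ∑' γ, ENNReal.ofReal (f.coeff γ) *
          ∑' α, ENNReal.ofReal (bCoeff f α) * F (γ ++ α) := by
  simp only [← ENNReal.tsum_mul_left]
  rw [tsum_coeff_mul_bCoeff,
    ← tsum_pi_single ([] : List (Fin n)) (F []), ← ENNReal.tsum_add]
  refine tsum_congr fun δ => ?_
  rcases eq_or_ne δ [] with rfl | hδ
  · simp [bCoeff_nil]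
  · simp [hδ]

theorem poissonForm_eq (f : PosRegFreeHol n) (X : Fin n → H →L[ℂ] H) (x : H) :
    poissonForm f X x = ‖defect f X x‖ₑ ^ 2
      + ∑' γ, ENNReal.ofReal (f.coeff γ) * poissonForm f X (adjoint (wordOp X γ) x) := by
  simp only [poissonForm, ← adjoint_wordOp_append]
  rw [tsum_bCoeff_eq, adjoint_wordOp_nil]

/-- Truncate to words of length less than `N`. The recursion peels off a nonempty prefix, so
induction on `N` applies at `X_γ* x`, and `defect_add` closes the step. -/
theorem IsContractiveFor.poissonForm_le {f : PosRegFreeHol n} {X : Fin n → H →L[ℂ] H}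
    (hX : IsContractiveFor f X) (x : H) : poissonForm f X x ≤ ‖x‖ₑ ^ 2 := by
  have key : ∀ (N : ℕ) (x : H), ∑' α, ENNReal.ofReal (bCoeff f α) *
      (if α.length < N then ‖defect f X (adjoint (wordOp X α) x)‖ₑ ^ 2 else 0) ≤ ‖x‖ₑ ^ 2 := by
    intro N
    induction N with
    | zero => simp
    | succ N ih =>
      intro x
      rw [tsum_bCoeff_eq, ← hX.defect_add x]
      refine add_le_add (by simp [adjoint_wordOp_nil]) (ENNReal.tsum_le_tsum fun γ => ?_)
      -- An empty prefix would not shorten the word; it drops out because `a_∅ = 0`.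
      rcases eq_or_ne γ [] with rfl | hγ
      · simp [f.coeff_nil]
      · refine mul_le_mul_right (le_trans (ENNReal.tsum_le_tsum fun α => ?_)
          (ih (adjoint (wordOp X γ) x))) _
        refine mul_le_mul_right ?_ _
        have : 0 < γ.length := List.length_pos_iff.2 hγ
        split_ifs with h1 h2
        · rw [adjoint_wordOp_append]
        · rw [List.length_append] at h1
          omega
        · exact zero_le
        · exact le_rfl
  rw [poissonForm, ENNReal.tsum_eq_iSup_sum]
  refine iSup_le fun s => le_trans ?_ (key (s.sup List.length + 1) x)
  refine le_trans (Finset.sum_le_sum fun α hα => ?_) (ENNReal.sum_le_tsum s)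
  rw [if_pos (Nat.lt_succ_of_le (Finset.le_sup (f := List.length) hα))]

/-- Each application of `Φ` prepends a nonempty word, so after `m` of them only words of length at
least `m` remain. -/
theorem phiForm_le_tail {f : PosRegFreeHol n} {X : Fin n → H →L[ℂ] H}
    (h : ∀ x, poissonForm f X x = ‖x‖ₑ ^ 2) (m : ℕ) (x : H) :
    phiForm f X m x ≤ ∑' α, ENNReal.ofReal (bCoeff f α) *
      (if m ≤ α.length then ‖defect f X (adjoint (wordOp X α) x)‖ₑ ^ 2 else 0) := by
  induction m generalizing x with
  | zero =>
    simp only [zero_le, if_true]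
    exact (h x).ge
  | succ m ih =>
    rw [tsum_bCoeff_eq]
    refine le_add_left (ENNReal.tsum_le_tsum fun γ => ?_)
    rcases eq_or_ne γ [] with rfl | hγ
    · simp [f.coeff_nil]
    · refine mul_le_mul_right ((ih _).trans (ENNReal.tsum_le_tsum fun α => ?_)) _
      refine mul_le_mul_right ?_ _
      have : 0 < γ.length := List.length_pos_iff.2 hγ
      split_ifs with h1 h2
      · rw [adjoint_wordOp_append]
      · rw [List.length_append] at h2
        omega
      · exact zero_le
      · exact le_rfl

theorem tendsto_phiForm_of_poissonForm_eq {f : PosRegFreeHol n} {X : Fin n → H →L[ℂ] H}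
    (h : ∀ x, poissonForm f X x = ‖x‖ₑ ^ 2) (x : H) :
    Tendsto (fun m => phiForm f X m x) atTop (𝓝 0) := by
  have ht := ENNReal.tendsto_tsum_compl_atTop_zero
    (f := fun α => ENNReal.ofReal (bCoeff f α) * ‖defect f X (adjoint (wordOp X α) x)‖ₑ ^ 2)
    (by
      change poissonForm f X x ≠ ∞
      rw [h]
      simp)
  rw [ENNReal.tendsto_nhds_zero] at ht ⊢
  intro ε hε
  obtain ⟨s, hs⟩ := (ht ε hε).exists
  filter_upwards [eventually_gt_atTop (s.sup List.length)] with m hm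
  refine (phiForm_le_tail h m x).trans (le_trans ?_ hs)
  change _ ≤ ∑' b : {α | α ∉ s}, ENNReal.ofReal (bCoeff f b)
    * ‖defect f X (adjoint (wordOp X b) x)‖ₑ ^ 2
  rw [tsum_subtype {α | α ∉ s} fun α =>
    ENNReal.ofReal (bCoeff f α) * ‖defect f X (adjoint (wordOp X α) x)‖ₑ ^ 2]
  refine ENNReal.tsum_le_tsum fun α => ?_
  split_ifs with h1
  · have hα : α ∉ s := fun hα => by
      have := Finset.le_sup (f := List.length) hα
      omega
    rw [Set.indicator_of_mem (by exact hα)]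
  · simp

end

section

variable {n : ℕ}

open ContinuousLinearMap (adjoint)

/-! ## The canonical basis of the Fock space -/

theorem single_eq_smul_basisVec (α : List (Fin n)) (c : ℂ) :
    (lp.single 2 α c : Fock n) = c • basisVec α := by
  rw [basisVec, ← lp.single_smul, smul_eq_mul, mul_one]

theorem inner_basisVec_left (α : List (Fin n)) (φ : Fock n) : ⟪basisVec α, φ⟫_ℂ = φ α := by
  rw [basisVec, lp.inner_single_left]
  simp

theorem basisVec_apply (α β : List (Fin n)) :
    (basisVec α : Fock n) β = if β = α then 1 else 0 := by
  rw [basisVec, lp.single_apply, Pi.single_apply]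

/-- The linear span of the basis vectors. -/
noncomputable def fockPolynomials (n : ℕ) : Submodule ℂ (Fock n) :=
  Submodule.span ℂ (Set.range basisVec)

theorem basisVec_mem_fockPolynomials (α : List (Fin n)) : basisVec α ∈ fockPolynomials n :=
  Submodule.subset_span ⟨α, rfl⟩

theorem eq_top_of_basisVec_mem {S : Submodule ℂ (Fock n)} (hS : IsClosed (S : Set (Fock n)))
    (h : ∀ α, basisVec α ∈ S) : S = ⊤ := by
  refine eq_top_iff.2 fun φ _ => ?_
  refine hS.mem_of_tendsto (lp.hasSum_single (by norm_num) φ) (Eventually.of_forall fun s => ?_)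
  refine S.sum_mem fun α _ => ?_
  rw [single_eq_smul_basisVec]
  exact S.smul_mem _ (h α)

theorem map_mem_of_basisVec {F : Type*} [NormedAddCommGroup F] [NormedSpace ℂ F]
    {S : Submodule ℂ F} (hS : IsClosed (S : Set F)) (A : Fock n →L[ℂ] F)
    (h : ∀ α, A (basisVec α) ∈ S) (φ : Fock n) : A φ ∈ S := by
  have : S.comap A.toLinearMap = ⊤ :=
    eq_top_of_basisVec_mem (hS.preimage A.continuous) h
  exact this.ge (Submodule.mem_top (x := φ))

theorem fock_ext {F : Type*} [NormedAddCommGroup F] [NormedSpace ℂ F] {A B : Fock n →L[ℂ] F}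
    (h : ∀ α, A (basisVec α) = B (basisVec α)) : A = B := by
  ext φ
  have := map_mem_of_basisVec (S := ⊥) (by simp) (A - B)
    (fun α => by simp [h]) φ
  simpa [sub_eq_zero] using this

/-- The weights telescope. -/
theorem wordOp_weightedShift_basisVec (f : PosRegFreeHol n) (β γ : List (Fin n)) :
    wordOp (weightedShift f) β (basisVec γ)
      = (√(bCoeff f γ / bCoeff f (β ++ γ)) : ℂ) • basisVec (β ++ γ) := by
  induction β with
  | nil => simp [wordOp_nil, div_self (bCoeff_pos f γ).ne']
  | cons i β ih =>
    rw [wordOp_cons, ContinuousLinearMap.comp_apply, ih, map_smul, weightedShift_basisVec,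
      smul_smul, ← Complex.ofReal_mul,
      ← Real.sqrt_mul (div_nonneg (bCoeff_nonneg f _) (bCoeff_nonneg f _)),
      div_mul_div_cancel₀ (bCoeff_pos f _).ne']
    rfl

/-! ## Evaluation of noncommutative polynomials -/

section Intertwining

variable {E F : Type*} [NormedAddCommGroup E] [InnerProductSpace ℂ E]
  [NormedAddCommGroup F] [InnerProductSpace ℂ F]

theorem lift_apply_of_intertwining {X : Fin n → E →L[ℂ] E} {Y : Fin n → F →L[ℂ] F} (R : E →L[ℂ] F)
    (h : ∀ i x, R (X i x) = Y i (R x)) (p : FreeAlgebra ℂ (Fin n)) (x : E) :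
    R (FreeAlgebra.lift ℂ X p x) = FreeAlgebra.lift ℂ Y p (R x) := by
  induction p generalizing x with
  | grade0 r => simp [Algebra.algebraMap_eq_smul_one]
  | grade1 i => simpa using h i x
  | mul a b ha hb => simp [ha, hb]
  | add a b ha hb => simp [ha, hb]

theorem lift_prod_map (X : Fin n → E →L[ℂ] E) (α : List (Fin n)) :
    FreeAlgebra.lift ℂ X (α.map (FreeAlgebra.ι ℂ)).prod = wordOp X α := by
  simp [wordOp, map_list_prod, Function.comp_def]

end Intertwining

theorem weightedShift_mem_fockPolynomials (f : PosRegFreeHol n) (i : Fin n) {x : Fock n}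
    (hx : x ∈ fockPolynomials n) : weightedShift f i x ∈ fockPolynomials n := by
  have : fockPolynomials n ≤ (fockPolynomials n).comap (weightedShift f i).toLinearMap := by
    refine Submodule.span_le.2 ?_
    rintro _ ⟨α, rfl⟩
    change weightedShift f i (basisVec α) ∈ fockPolynomials n
    rw [weightedShift_basisVec]
    exact Submodule.smul_mem _ _ (basisVec_mem_fockPolynomials _)
  exact this hx

theorem lift_mem_fockPolynomials (f : PosRegFreeHol n) (p : FreeAlgebra ℂ (Fin n)) {x : Fock n}
    (hx : x ∈ fockPolynomials n) :
    FreeAlgebra.lift ℂ (weightedShift f) p x ∈ fockPolynomials n := by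
  induction p generalizing x with
  | grade0 r =>
    rw [AlgHom.commutes, Algebra.algebraMap_eq_smul_one]
    exact Submodule.smul_mem _ r hx
  | grade1 i =>
    rw [FreeAlgebra.lift_ι_apply]
    exact weightedShift_mem_fockPolynomials f i hx
  | mul a b ha hb =>
    rw [map_mul]
    exact ha (hb hx)
  | add a b ha hb =>
    rw [map_add]
    exact Submodule.add_mem _ (ha hx) (hb hx)

/-! ## The weighted right creation operators and the Hardy algebra -/

/-- Constructs the adjoint of the right shift, whose coordinates need no case distinction;
`bCoeff_mul_coeff_le` bounds its weights. -/
theorem exists_rightShift_adjoint (f : PosRegFreeHol n) (j : Fin n) :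
    ∃ R : Fock n →L[ℂ] Fock n, ∀ φ α,
      R φ α = (√(bCoeff f α / bCoeff f (α ++ [j])) : ℂ) * φ (α ++ [j]) := by
  let S : List (Fin n) → Fock n →L[ℂ] ℂ := fun α =>
    (√(bCoeff f α / bCoeff f (α ++ [j])) : ℂ) • innerSL ℂ (basisVec (α ++ [j]))
  have hSφ : ∀ α φ, S α φ = (√(bCoeff f α / bCoeff f (α ++ [j])) : ℂ) * φ (α ++ [j]) := by
    intro α φ
    rw [smul_apply, innerSL_apply_apply, inner_basisVec_left, smul_eq_mul]
  have hinj : Function.Injective fun α : List (Fin n) => α ++ [j] :=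
    fun _ _ h => List.append_cancel_right h
  have hS : ∀ φ, ∑' α, ‖S α φ‖ₑ ^ 2 ≤ Real.toNNReal (f.coeff [j])⁻¹ * ‖φ‖ₑ ^ 2 := by
    intro φ
    calc _ ≤ ∑' α, ENNReal.ofReal (f.coeff [j])⁻¹ * ‖φ (α ++ [j])‖ₑ ^ 2 := by
          refine ENNReal.tsum_le_tsum fun α => ?_
          have h0 : 0 ≤ bCoeff f α / bCoeff f (α ++ [j]) :=
            div_nonneg (bCoeff_nonneg f _) (bCoeff_nonneg f _)
          rw [hSφ, enorm_mul, mul_pow, enorm_sq_eq_ofReal, Complex.norm_real, Real.norm_eq_abs, sq_abs,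
            Real.sq_sqrt h0]
          gcongr
          rw [div_le_iff₀ (bCoeff_pos f _), inv_mul_eq_div, le_div_iff₀ (f.coeff_letter_pos j),
            mul_comm]
          exact bCoeff_mul_coeff_le f j α
      _ ≤ ENNReal.ofReal (f.coeff [j])⁻¹ * ‖φ‖ₑ ^ 2 := by
          rw [ENNReal.tsum_mul_left, lp_enorm_sq]
          exact mul_le_mul_right
            (ENNReal.tsum_comp_le_tsum_of_injective hinj fun α => ‖φ α‖ₑ ^ 2) _
  obtain ⟨V, hV⟩ := exists_toLp_of_tsum_le S _ hS
  exact ⟨V, fun φ α => (hV φ α).trans (hSφ α φ)⟩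

/-- The weighted right creation operator `Λ_j`, with `Λ_j e_α = √(b_α / b_{α g_j}) e_{α g_j}`. -/
noncomputable def rightShift (f : PosRegFreeHol n) (j : Fin n) : Fock n →L[ℂ] Fock n :=
  adjoint (exists_rightShift_adjoint f j).choose

theorem rightShift_basisVec (f : PosRegFreeHol n) (j : Fin n) (α : List (Fin n)) :
    rightShift f j (basisVec α)
      = (√(bCoeff f α / bCoeff f (α ++ [j])) : ℂ) • basisVec (α ++ [j]) := by
  ext w
  rw [← inner_basisVec_left, rightShift, ContinuousLinearMap.adjoint_inner_right,
    ← inner_conj_symm, inner_basisVec_left, (exists_rightShift_adjoint f j).choose_spec,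
    lp.coeFn_smul, Pi.smul_apply, basisVec_apply, basisVec_apply]
  by_cases h : w = α ++ [j]
  · simp [h]
  · simp [h, Ne.symm h]

theorem basisVec_append_singleton (f : PosRegFreeHol n) (j : Fin n) (α : List (Fin n)) :
    basisVec (α ++ [j])
      = (√(bCoeff f α / bCoeff f (α ++ [j])) : ℂ)⁻¹ • rightShift f j (basisVec α) := by
  have h : (√(bCoeff f α / bCoeff f (α ++ [j])) : ℂ) ≠ 0 :=
    Complex.ofReal_ne_zero.2 (Real.sqrt_pos.2 (div_pos (bCoeff_pos f _) (bCoeff_pos f _))).ne'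
  rw [rightShift_basisVec, inv_smul_smul₀ h]

/-- In either order the weights telescope to `√(b_α / b_{g_i α g_j})`. -/
theorem rightShift_comp_weightedShift (f : PosRegFreeHol n) (i j : Fin n) :
    rightShift f j ∘L weightedShift f i = weightedShift f i ∘L rightShift f j := by
  refine fock_ext fun α => ?_
  have h0 : ∀ α β, 0 ≤ bCoeff f α / bCoeff f β :=
    fun α β => div_nonneg (bCoeff_nonneg f _) (bCoeff_nonneg f _)
  simp only [ContinuousLinearMap.comp_apply, weightedShift_basisVec, rightShift_basisVec,
    map_smul, smul_smul, ← Complex.ofReal_mul, ← Real.sqrt_mul (h0 _ _), List.cons_append,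
    div_mul_div_cancel₀ (bCoeff_pos f _).ne']

theorem rightShift_lift (f : PosRegFreeHol n) (j : Fin n) (p : FreeAlgebra ℂ (Fin n))
    (x : Fock n) :
    rightShift f j (FreeAlgebra.lift ℂ (weightedShift f) p x)
      = FreeAlgebra.lift ℂ (weightedShift f) p (rightShift f j x) :=
  lift_apply_of_intertwining _
    (fun i x => DFunLike.congr_fun (rightShift_comp_weightedShift f i j) x) p x

theorem rightShift_wordOp (f : PosRegFreeHol n) (j : Fin n) (α : List (Fin n)) (x : Fock n) :
    rightShift f j (wordOp (weightedShift f) α x)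
      = wordOp (weightedShift f) α (rightShift f j x) := by
  rw [← lift_prod_map, rightShift_lift]

/-- The Hardy algebra is the commutant of the weighted right creation operators. -/
theorem mem_hardy_iff {f : PosRegFreeHol n} {A : Fock n →L[ℂ] Fock n} :
    A ∈ hardy f ↔ ∀ j, A ∘L rightShift f j = rightShift f j ∘L A := by
  constructor
  · rintro ⟨c, -, hA⟩ j
    refine fock_ext fun γ => ?_
    have h1 := (hA (γ ++ [j])).const_smul (√(bCoeff f γ / bCoeff f (γ ++ [j])) : ℂ)
    have h2 := (hA γ).mapL (rightShift f j)
    rw [← map_smul, ← rightShift_basisVec] at h1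
    refine h1.unique (h2.congr_fun fun β => ?_)
    rw [map_smul, rightShift_wordOp, rightShift_basisVec, map_smul, smul_comm]
  · intro hA
    have hb : ∀ β, (√(bCoeff f β) : ℂ) ≠ 0 := fun β =>
      Complex.ofReal_ne_zero.2 (Real.sqrt_pos.2 (bCoeff_pos f β)).ne'
    -- The coefficients are forced by `A e_∅`, because `W_β e_∅ = e_β / √b_β`.
    refine ⟨fun β => (√(bCoeff f β) : ℂ) * A (basisVec []) β, ?_, fun γ => ?_⟩
    · refine (norm_sq_summable (A (basisVec []))).congr fun β => ?_
      rw [norm_mul, mul_pow, Complex.norm_real, Real.norm_eq_abs, sq_abs,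
        Real.sq_sqrt (bCoeff_nonneg f β), mul_div_cancel_left₀ _ (bCoeff_pos f β).ne',
        Real.rpow_two]
    -- Letters are added on the right: `Λ_j` commutes with `A` and every `W_β`, so it carries the
    -- expansion at `e_γ` to `e_{γ g_j}`.
    · induction γ using List.reverseRecOn with
      | nil =>
        refine (lp.hasSum_single (by norm_num) (A (basisVec []))).congr_fun fun β => ?_
        rw [wordOp_weightedShift_basisVec, single_eq_smul_basisVec, smul_smul, List.append_nil,
          bCoeff_nil, one_div, Real.sqrt_inv, Complex.ofReal_inv, mul_right_comm,
          mul_inv_cancel₀ (hb β), one_mul]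
      | append_singleton γ j ih =>
        have h := (ih.mapL (rightShift f j)).const_smul
          (√(bCoeff f γ / bCoeff f (γ ++ [j])) : ℂ)⁻¹
        rw [← ContinuousLinearMap.comp_apply, ← hA j, ContinuousLinearMap.comp_apply, ← map_smul,
          ← basisVec_append_singleton] at h
        refine h.congr_fun fun β => ?_
        rw [map_smul, rightShift_wordOp, smul_comm, basisVec_append_singleton f, map_smul]

theorem lift_mem_hardy (f : PosRegFreeHol n) (p : FreeAlgebra ℂ (Fin n)) :
    FreeAlgebra.lift ℂ (weightedShift f) p ∈ hardy f :=
  mem_hardy_iff.2 fun j => by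
    ext1 x
    exact (rightShift_lift f j p x).symm

theorem mul_mem_hardy {f : PosRegFreeHol n} {A B : Fock n →L[ℂ] Fock n} (hA : A ∈ hardy f)
    (hB : B ∈ hardy f) : A * B ∈ hardy f := by
  rw [mem_hardy_iff] at *
  intro j
  exact Commute.mul_left (hA j) (hB j)

/-- The coefficients of an element of the Hardy algebra determine its action on polynomials. -/
theorem exists_hasSum_of_mem_hardy {f : PosRegFreeHol n} {A : Fock n →L[ℂ] Fock n}
    (hA : A ∈ hardy f) : ∃ c : List (Fin n) → ℂ, ∀ x ∈ fockPolynomials n,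
      HasSum (fun β => c β • wordOp (weightedShift f) β x) (A x) := by
  obtain ⟨c, -, hc⟩ := hA
  refine ⟨c, fun x hx => ?_⟩
  induction hx using Submodule.span_induction with
  | mem x hx =>
    obtain ⟨γ, rfl⟩ := hx
    exact hc γ
  | zero => simp
  | add x y _ _ hx hy =>
    simpa [smul_add] using hx.add hy
  | smul r x _ hx =>
    simpa [smul_comm r] using hx.const_smul r

/-! ## An explicit `w*`-closed ideal containing the generators -/

/-- A matrix coefficient is the functional given by two sequences supported at index `0`. -/
theorem continuous_inner_apply_weakStar {E : Type*} [NormedAddCommGroup E] [InnerProductSpace ℂ E]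
    (x y : E) : Continuous[weakStarTopology E, _] fun A : E →L[ℂ] E => ⟪x, A y⟫_ℂ := by
  have h : (fun A : E →L[ℂ] E => ⟪x, A y⟫_ℂ) = fun A : E →L[ℂ] E =>
      ∑' k, ⟪(lp.single 2 0 x : lp (fun _ : ℕ => E) 2) k,
        A ((lp.single 2 0 y : lp (fun _ : ℕ => E) 2) k)⟫_ℂ := by
    ext A
    rw [tsum_eq_single 0 fun k hk => by rw [lp.single_apply_ne _ _ _ hk, inner_zero_left],
      lp.single_apply_self, lp.single_apply_self]
  rw [h]
  exact continuous_iInf_dom (continuous_iInf_dom continuous_induced_dom)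

theorem isClosed_weakStar_setOf_inner_eq {E : Type*} [NormedAddCommGroup E] [InnerProductSpace ℂ E]
    (x y x' y' : E) :
    IsClosed[weakStarTopology E] {A : E →L[ℂ] E | ⟪x, A y⟫_ℂ = ⟪x', A y'⟫_ℂ} :=
  let _ := weakStarTopology E
  isClosed_eq (continuous_inner_apply_weakStar x y) (continuous_inner_apply_weakStar x' y')

theorem isClosed_hardy (f : PosRegFreeHol n) :
    IsClosed[weakStarTopology (Fock n)] (hardy f) := by
  let _ := weakStarTopology (Fock n)
  have : hardy f = ⋂ (j) (x : Fock n) (y : Fock n), {A : Fock n →L[ℂ] Fock n |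
      ⟪x, A (rightShift f j y)⟫_ℂ = ⟪adjoint (rightShift f j) x, A y⟫_ℂ} := by
    ext A
    simp only [Set.mem_iInter, Set.mem_ofPred_eq, ContinuousLinearMap.adjoint_inner_left,
      mem_hardy_iff]
    refine forall_congr' fun j => ⟨fun h x y => ?_, fun h => ?_⟩
    · rw [← ContinuousLinearMap.comp_apply, h, ContinuousLinearMap.comp_apply]
    · ext1 y
      exact ext_inner_left ℂ fun x => h x y
  rw [this]
  exact isClosed_iInter fun j => isClosed_iInter fun x => isClosed_iInter fun y =>
    isClosed_weakStar_setOf_inner_eq _ _ _ _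

/-- The closed span of the vectors `p(W) q(W) e_γ` with `q` a generator. -/
noncomputable def generatedRange (f : PosRegFreeHol n) (P : Set (FreeAlgebra ℂ (Fin n))) :
    Submodule ℂ (Fock n) :=
  (Submodule.span ℂ {x | ∃ p, ∃ q ∈ P, ∃ γ,
    x = FreeAlgebra.lift ℂ (weightedShift f) (p * q) (basisVec γ)}).topologicalClosure

theorem isClosed_generatedRange (f : PosRegFreeHol n) (P : Set (FreeAlgebra ℂ (Fin n))) :
    IsClosed (generatedRange f P : Set (Fock n)) :=
  Submodule.isClosed_topologicalClosure _

theorem lift_mul_basisVec_mem_generatedRange (f : PosRegFreeHol n)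
    {P : Set (FreeAlgebra ℂ (Fin n))} (p : FreeAlgebra ℂ (Fin n)) {q : FreeAlgebra ℂ (Fin n)}
    (hq : q ∈ P) (γ : List (Fin n)) :
    FreeAlgebra.lift ℂ (weightedShift f) (p * q) (basisVec γ) ∈ generatedRange f P :=
  Submodule.le_topologicalClosure _ (Submodule.subset_span ⟨p, q, hq, γ, rfl⟩)

theorem generatedRange_le {f : PosRegFreeHol n} {P : Set (FreeAlgebra ℂ (Fin n))}
    {S : Submodule ℂ (Fock n)} (hS : IsClosed (S : Set (Fock n)))
    (h : ∀ p, ∀ q ∈ P, ∀ γ, FreeAlgebra.lift ℂ (weightedShift f) (p * q) (basisVec γ) ∈ S) :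
    generatedRange f P ≤ S := by
  refine Submodule.topologicalClosure_minimal _ (Submodule.span_le.2 ?_) hS
  rintro _ ⟨p, q, hq, γ, rfl⟩
  exact h p q hq γ

/-- On `p(W) q(W) e_γ`, which is a polynomial vector, `A` acts as the limit of partial sums of `c_β
W_β p(W) q(W) e_γ`, all in the span. -/
theorem map_mem_generatedRange {f : PosRegFreeHol n} {P : Set (FreeAlgebra ℂ (Fin n))}
    {A : Fock n →L[ℂ] Fock n} (hA : A ∈ hardy f) {x : Fock n} (hx : x ∈ generatedRange f P) :
    A x ∈ generatedRange f P := by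
  obtain ⟨c, hc⟩ := exists_hasSum_of_mem_hardy hA
  have hS := isClosed_generatedRange f P
  refine generatedRange_le (S := (generatedRange f P).comap A.toLinearMap)
    (hS.preimage A.continuous) (fun p q hq γ => ?_) hx
  refine hS.mem_of_tendsto
    (hc _ (lift_mem_fockPolynomials f (p * q) (basisVec_mem_fockPolynomials γ)))
    (Eventually.of_forall fun s => Submodule.sum_mem _ fun β _ => Submodule.smul_mem _ _ ?_)
  rw [← lift_prod_map, ← mul_apply_eq_comp, ← map_mul, ← mul_assoc]
  exact lift_mul_basisVec_mem_generatedRange f _ hq γ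

/-- The elements of the Hardy algebra with range in `generatedRange f P`. -/
def rangeIdeal (f : PosRegFreeHol n) (P : Set (FreeAlgebra ℂ (Fin n))) :
    Submodule ℂ (Fock n →L[ℂ] Fock n) where
  carrier := {A | A ∈ hardy f ∧ ∀ γ, A (basisVec γ) ∈ generatedRange f P}
  add_mem' := by
    rintro A B ⟨hA, hA'⟩ ⟨hB, hB'⟩
    refine ⟨mem_hardy_iff.2 fun j => ?_, fun γ => Submodule.add_mem _ (hA' γ) (hB' γ)⟩
    rw [ContinuousLinearMap.add_comp, ContinuousLinearMap.comp_add, mem_hardy_iff.1 hA,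
      mem_hardy_iff.1 hB]
  zero_mem' := ⟨mem_hardy_iff.2 fun j => by simp, fun γ => Submodule.zero_mem _⟩
  smul_mem' := by
    rintro c A ⟨hA, hA'⟩
    refine ⟨mem_hardy_iff.2 fun j => ?_, fun γ => Submodule.smul_mem _ _ (hA' γ)⟩
    rw [ContinuousLinearMap.smul_comp, ContinuousLinearMap.comp_smul, mem_hardy_iff.1 hA]

/-- Left multiplication uses invariance of the subspace under the Hardy algebra; right
multiplication only uses that the whole range of `B` lies in it. Closedness comes from testing the
range against the orthogonal complement. -/
theorem isWeakStarClosedIdeal_rangeIdeal (f : PosRegFreeHol n)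
    (P : Set (FreeAlgebra ℂ (Fin n))) : IsWeakStarClosedIdeal f (rangeIdeal f P) where
  subset_hardy A hA := hA.1
  mul_left_mem A hA B hB :=
    ⟨mul_mem_hardy hA hB.1, fun γ => map_mem_generatedRange hA (hB.2 γ)⟩
  mul_right_mem A hA B hB :=
    ⟨mul_mem_hardy hB.1 hA, fun γ =>
      map_mem_of_basisVec (isClosed_generatedRange f P) B hB.2 (A (basisVec γ))⟩
  closed := by
    let _ := weakStarTopology (Fock n)
    -- The right-hand side `⟪0, A 0⟫` is zero, written so that `isClosed_weakStar_setOf_inner_eq`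
    -- applies.
    have h : (rangeIdeal f P : Set (Fock n →L[ℂ] Fock n)) = hardy f ∩
        ⋂ (γ) (x ∈ (generatedRange f P)ᗮ), {A : Fock n →L[ℂ] Fock n |
          ⟪x, A (basisVec γ)⟫_ℂ = ⟪(0 : Fock n), A 0⟫_ℂ} := by
      ext A
      refine and_congr_right fun _ => ?_
      simp only [Set.mem_iInter, Set.mem_ofPred_eq, inner_zero_left]
      refine forall_congr' fun γ => ?_
      rw [← Submodule.mem_orthogonal, Submodule.orthogonal_orthogonal_eq_closure, generatedRange,
        (Submodule.isClosed_topologicalClosure _).submodule_topologicalClosure_eq]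
    rw [h]
    exact (isClosed_hardy f).inter (isClosed_iInter fun γ => isClosed_iInter fun x =>
      isClosed_iInter fun _ => isClosed_weakStar_setOf_inner_eq _ _ _ _)

theorem generatedIdeal_le_rangeIdeal (f : PosRegFreeHol n) (P : Set (FreeAlgebra ℂ (Fin n))) :
    generatedIdeal f P ≤ rangeIdeal f P := by
  refine sInf_le ⟨isWeakStarClosedIdeal_rangeIdeal f P,
    fun q hq => ⟨lift_mem_hardy f q, fun γ => ?_⟩⟩
  simpa using lift_mul_basisVec_mem_generatedRange f 1 hq γ

theorem idealRange_generatedIdeal_le (f : PosRegFreeHol n) (P : Set (FreeAlgebra ℂ (Fin n))) :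
    idealRange (generatedIdeal f P) ≤ generatedRange f P := by
  refine Submodule.topologicalClosure_minimal _ (Submodule.span_le.2 ?_)
    (isClosed_generatedRange f P)
  rintro _ ⟨A, hA, φ, rfl⟩
  exact map_mem_of_basisVec (isClosed_generatedRange f P) A
    (generatedIdeal_le_rangeIdeal f P hA).2 φ

/-- An operator intertwining the universal model with a tuple annihilated by the generators
vanishes on `M_J`. -/
theorem apply_eq_zero_of_mem_idealRange {f : PosRegFreeHol n} {P : Set (FreeAlgebra ℂ (Fin n))}
    {H : Type*} [NormedAddCommGroup H] [InnerProductSpace ℂ H] {T : Fin n → H →L[ℂ] H}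
    (hT : ∀ q ∈ P, FreeAlgebra.lift ℂ T q = 0) (R : Fock n →L[ℂ] H)
    (hR : ∀ i φ, R (weightedShift f i φ) = T i (R φ)) {φ : Fock n}
    (hφ : φ ∈ idealRange (generatedIdeal f P)) : R φ = 0 := by
  refine generatedRange_le (S := LinearMap.ker R.toLinearMap) R.isClosed_ker
    (fun p q hq γ => ?_) (idealRange_generatedIdeal_le f P hφ)
  rw [LinearMap.mem_ker]
  refine (lift_apply_of_intertwining R hR (p * q) (basisVec γ)).trans ?_
  rw [map_mul, hT q hq, mul_zero]
  rfl

end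

section

variable {n : ℕ}

open ContinuousLinearMap (adjoint)

/-! ## Hilbert tensor products with subspaces of the Fock space -/

section Tensor

variable {E D G : Type*} [NormedAddCommGroup E] [InnerProductSpace ℂ E]
  [NormedAddCommGroup D] [InnerProductSpace ℂ D] [NormedAddCommGroup G] [InnerProductSpace ℂ G]

theorem hilbertTensor_ext {A B : HilbertTensor E D →L[ℂ] G}
    (h : ∀ (x : E) (y : D), A ((x ⊗ₜ[ℂ] y : E ⊗[ℂ] D) : HilbertTensor E D)
      = B ((x ⊗ₜ[ℂ] y : E ⊗[ℂ] D) : HilbertTensor E D)) : A = B := by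
  ext1 w
  induction w using UniformSpace.Completion.induction_on with
  | hp => exact isClosed_eq A.continuous B.continuous
  | ih w =>
    induction w using TensorProduct.induction_on with
    | zero => rw [UniformSpace.Completion.coe_zero, map_zero, map_zero]
    | tmul x y => exact h x y
    | add w z hw hz => rw [UniformSpace.Completion.coe_add, map_add, map_add, hw, hz]

theorem exists_isometry_completion [CompleteSpace G] (u : E →ₗᵢ[ℂ] G) :
    ∃ v : UniformSpace.Completion E →ₗᵢ[ℂ] G, ∀ x : E, v x = u x := by
  have hd : DenseRange (UniformSpace.Completion.toComplL : E →L[ℂ] UniformSpace.Completion E) :=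
    UniformSpace.Completion.denseRange_coe
  have hi : IsUniformInducing
      (UniformSpace.Completion.toComplL : E →L[ℂ] UniformSpace.Completion E) :=
    UniformSpace.Completion.isUniformInducing_coe E
  let w : UniformSpace.Completion E →L[ℂ] G :=
    u.toContinuousLinearMap.extend UniformSpace.Completion.toComplL
  have hw : ∀ x : E, w x = u x := fun x => u.toContinuousLinearMap.extend_eq hd hi x
  refine ⟨⟨w.toLinearMap, fun x => ?_⟩, hw⟩
  induction x using UniformSpace.Completion.induction_on with
  | hp => exact isClosed_eq w.continuous.norm continuous_norm
  | ih x =>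
    change ‖w x‖ = _
    rw [hw, u.norm_map, UniformSpace.Completion.norm_coe]

variable {ι : Type*}

theorem memℓp_smul (φ : lp (fun _ : ι => ℂ) 2) (y : D) : Memℓp (fun α => φ α • y) 2 := by
  refine memℓp_two_of_tsum_ne_top ?_
  simp only [enorm_smul, mul_pow]
  rw [ENNReal.tsum_mul_right, ← lp_enorm_sq]
  exact ENNReal.mul_ne_top (by simp) (by simp)

/-- The family `(φ_α y)_α`. -/
noncomputable def lpSmul (φ : lp (fun _ : ι => ℂ) 2) (y : D) : lp (fun _ : ι => D) 2 :=
  ⟨fun α => φ α • y, memℓp_smul φ y⟩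

theorem lpSmul_apply (φ : lp (fun _ : ι => ℂ) 2) (y : D) (α : ι) : lpSmul φ y α = φ α • y := rfl

theorem inner_lpSmul (φ ψ : lp (fun _ : ι => ℂ) 2) (y z : D) :
    ⟪lpSmul φ y, lpSmul ψ z⟫_ℂ = ⟪φ, ψ⟫_ℂ * ⟪y, z⟫_ℂ := by
  rw [lp.inner_eq_tsum, lp.inner_eq_tsum, ← tsum_mul_right]
  refine tsum_congr fun α => ?_
  rw [lpSmul_apply, lpSmul_apply, inner_smul_left, inner_smul_right, RCLike.inner_apply]
  ring

theorem norm_lpSmul (φ : lp (fun _ : ι => ℂ) 2) (y : D) : ‖lpSmul φ y‖ = ‖φ‖ * ‖y‖ := by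
  have h : ‖lpSmul φ y‖ₑ ^ 2 = (‖φ‖ₑ * ‖y‖ₑ) ^ 2 := by
    rw [lp_enorm_sq, mul_pow, lp_enorm_sq, ← ENNReal.tsum_mul_right]
    simp only [lpSmul_apply, enorm_smul, mul_pow]
  have h' := congrArg ENNReal.toReal ((ENNReal.pow_right_strictMono two_ne_zero).injective h)
  simpa using h'

/-- `φ ↦ y ↦ (φ_α y)_α` as a bounded bilinear map. -/
noncomputable def lpSmulL (ι D : Type*) [NormedAddCommGroup D] [InnerProductSpace ℂ D] :
    lp (fun _ : ι => ℂ) 2 →L[ℂ] D →L[ℂ] lp (fun _ : ι => D) 2 :=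
  LinearMap.mkContinuous₂
    (LinearMap.mk₂ ℂ lpSmul
      (fun φ ψ y => by ext α; exact add_smul (φ α) (ψ α) y)
      (fun c φ y => by ext α; exact smul_assoc c (φ α) y)
      (fun φ y z => by ext α; exact smul_add (φ α) y z)
      (fun c φ y => by ext α; exact smul_comm (φ α) c y)) 1
    (fun φ y => by rw [one_mul]; exact (norm_lpSmul φ y).le)

theorem lpSmulL_apply (φ : lp (fun _ : ι => ℂ) 2) (y : D) : lpSmulL ι D φ y = lpSmul φ y := rfl

/-- For a subspace `E` of `ℓ²`, the Hilbert tensor product of `E` and `D` embeds into `ℓ²(D)`. -/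
theorem exists_tensor_isometry [CompleteSpace D] (j : E →ₗᵢ[ℂ] lp (fun _ : ι => ℂ) 2) :
    ∃ v : HilbertTensor E D →ₗᵢ[ℂ] lp (fun _ : ι => D) 2, ∀ (φ : E) (y : D),
      v ((φ ⊗ₜ[ℂ] y : E ⊗[ℂ] D) : HilbertTensor E D) = lpSmul (j φ) y := by
  let u : E ⊗[ℂ] D →ₗ[ℂ] lp (fun _ : ι => D) 2 :=
    TensorProduct.lift ((lpSmulL ι D).toLinearMap₁₂ ∘ₗ j.toLinearMap)
  have hu : ∀ (φ : E) (y : D), u (φ ⊗ₜ[ℂ] y) = lpSmul (j φ) y :=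
    fun φ y => TensorProduct.lift.tmul φ y
  have hinner : ∀ x z, ⟪u x, u z⟫_ℂ = ⟪x, z⟫_ℂ := by
    intro x z
    induction x using TensorProduct.induction_on with
    | zero => simp
    | add x x' hx hx' => rw [map_add, inner_add_left, inner_add_left, hx, hx']
    | tmul φ y =>
      induction z using TensorProduct.induction_on with
      | zero => simp
      | add z z' hz hz' => rw [map_add, inner_add_right, inner_add_right, hz, hz']
      | tmul ψ z => rw [hu, hu, inner_lpSmul, TensorProduct.inner_tmul, j.inner_map_map]
  obtain ⟨v, hv⟩ := exists_isometry_completion (u.isometryOfInner hinner)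
  exact ⟨v, fun φ y => (hv _).trans (hu φ y)⟩

end Tensor

section Range

variable {D : Type*} [NormedAddCommGroup D] [InnerProductSpace ℂ D]

theorem lpSmul_basisVec (α : List (Fin n)) (y : D) :
    lpSmul (basisVec α) y = lp.single 2 α y := by
  ext β
  rw [lpSmul_apply, basisVec_apply, lp.single_apply, Pi.single_apply, ite_smul, one_smul,
    zero_smul]

theorem lpSmul_sub (φ ψ : Fock n) (y : D) : lpSmul (φ - ψ) y = lpSmul φ y - lpSmul ψ y := by
  simp only [← lpSmulL_apply, map_sub, sub_apply]

theorem eq_zero_of_inner_lpSmul {z : lp (fun _ : List (Fin n) => D) 2}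
    (h : ∀ (φ : Fock n) y, ⟪lpSmul φ y, z⟫_ℂ = 0) : z = 0 := by
  ext α
  refine ext_inner_left ℂ fun y => ?_
  have := h (basisVec α) y
  rw [lpSmul_basisVec, lp.inner_single_left] at this
  exact this.trans (inner_zero_right y).symm

variable {E : Type*} [NormedAddCommGroup E] [InnerProductSpace ℂ E] [CompleteSpace E]

theorem inner_sub_adjoint_apply (j : E →ₗᵢ[ℂ] Fock n) (φ : Fock n) (e : E) :
    ⟪φ - j (adjoint j.toContinuousLinearMap φ), j e⟫_ℂ = 0 := by
  rw [inner_sub_left, j.inner_map_map, ContinuousLinearMap.adjoint_inner_left, sub_eq_zero]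
  rfl

/-- A vector of `ℓ²(D)` orthogonal to `(j E)ᗮ ⊗ D` lies in the image of the Hilbert tensor product
of `E` and `D`. -/
theorem tensor_isometry_adjoint_apply [CompleteSpace D] {j : E →ₗᵢ[ℂ] Fock n}
    {v : HilbertTensor E D →ₗᵢ[ℂ] lp (fun _ : List (Fin n) => D) 2}
    (hv : ∀ (e : E) (y : D),
      v ((e ⊗ₜ[ℂ] y : E ⊗[ℂ] D) : HilbertTensor E D) = lpSmul (j e) y)
    {z : lp (fun _ : List (Fin n) => D) 2}
    (hz : ∀ φ, (∀ e, ⟪φ, j e⟫_ℂ = 0) → ∀ y, ⟪lpSmul φ y, z⟫_ℂ = 0) :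
    v (adjoint v.toContinuousLinearMap z) = z := by
  have hperp : ∀ φ, (∀ e, ⟪φ, j e⟫_ℂ = 0) → ∀ y w, ⟪lpSmul φ y, v w⟫_ℂ = 0 := by
    intro φ hφ y w
    have h : innerSL ℂ (lpSmul φ y) ∘L v.toContinuousLinearMap = 0 := by
      refine hilbertTensor_ext fun ψ z => ?_
      change ⟪lpSmul φ y, v _⟫_ℂ = 0
      rw [hv, inner_lpSmul, hφ, zero_mul]
    exact DFunLike.congr_fun h w
  have hE : ∀ (e : E) (y : D),
      ⟪lpSmul (j e) y, v (adjoint v.toContinuousLinearMap z)⟫_ℂ = ⟪lpSmul (j e) y, z⟫_ℂ := by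
    intro e y
    rw [← hv, v.inner_map_map, ContinuousLinearMap.adjoint_inner_right]
    rfl
  -- Test `v v* z - z` against `φ ⊗ y`, splitting `φ` along `j E` and its complement: on the first
  -- part the two terms agree, on the second both vanish.
  refine sub_eq_zero.1 (eq_zero_of_inner_lpSmul fun φ y => ?_)
  have hmem := inner_sub_adjoint_apply j φ
  have hdec : lpSmul φ y = lpSmul (j (adjoint j.toContinuousLinearMap φ)) y
      + lpSmul (φ - j (adjoint j.toContinuousLinearMap φ)) y := by
    rw [lpSmul_sub]
    abel
  rw [hdec, inner_add_left, inner_sub_right, inner_sub_right, hE, sub_self, hperp _ hmem,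
    hz _ hmem, sub_self, add_zero]

/-- An operator into `ℓ²(D)` whose range is orthogonal to `(j E)ᗮ ⊗ D` factors through the Hilbert
tensor product of `E` and `D`, and intertwining relations pass to compressions. -/
theorem exists_compression_to_tensor [CompleteSpace D] {H : Type*} [NormedAddCommGroup H]
    [InnerProductSpace ℂ H] [CompleteSpace H] (j : E →ₗᵢ[ℂ] Fock n)
    (K : H →L[ℂ] lp (fun _ : List (Fin n) => D) 2)
    (hK : ∀ φ, (∀ e, ⟪φ, j e⟫_ℂ = 0) → ∀ y, adjoint K (lpSmul φ y) = 0) :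
    ∃ k : H →L[ℂ] HilbertTensor E D, (∀ x, ‖k x‖ = ‖K x‖) ∧
      ∀ (W : Fock n →L[ℂ] Fock n) (X : H →L[ℂ] H) (B : E →L[ℂ] E),
        (∀ e, B e = adjoint j.toContinuousLinearMap (W (j e))) →
        (∀ φ y, adjoint K (lpSmul (W φ) y) = X (adjoint K (lpSmul φ y))) →
        ∀ x, adjoint (ampliate B) (k x) = k (adjoint X x) := by
  obtain ⟨v, hv⟩ := exists_tensor_isometry (D := D) j
  have hproj : ∀ φ y,
      adjoint K (lpSmul (j (adjoint j.toContinuousLinearMap φ)) y) = adjoint K (lpSmul φ y) := by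
    intro φ y
    have h := hK _ (inner_sub_adjoint_apply j φ) y
    rw [lpSmul_sub, map_sub, sub_eq_zero] at h
    exact h.symm
  have hrange : ∀ x, v (adjoint v.toContinuousLinearMap (K x)) = K x := fun x =>
    tensor_isometry_adjoint_apply hv fun φ hφ y => by
      rw [← ContinuousLinearMap.adjoint_inner_left, hK φ hφ, inner_zero_left]
  -- Norms survive because `K` takes values in the range of the isometry `v`.
  refine ⟨adjoint v.toContinuousLinearMap ∘L K, fun x => ?_, fun W X B hB hW x => ?_⟩
  · exact (v.norm_map _).symm.trans (congrArg norm (hrange x))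
  -- The relation is proved for the adjoint `K* v`, where elementary tensors suffice and `hproj`
  -- removes the projection hidden in `B`.
  · have h : (adjoint K ∘L v.toContinuousLinearMap) ∘L ampliate B
        = X ∘L (adjoint K ∘L v.toContinuousLinearMap) := by
      refine hilbertTensor_ext fun e y => ?_
      simp only [ContinuousLinearMap.comp_apply, ampliate_tmul,
        LinearIsometry.coe_toContinuousLinearMap, hv, hB, hproj]
      exact hW (j e) y
    have h' := congrArg adjoint h
    simp only [ContinuousLinearMap.adjoint_comp, ContinuousLinearMap.adjoint_adjoint] at h'
    exact DFunLike.congr_fun h' x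

end Range

/-! ## The Poisson kernel of a tuple in the variety -/

variable {H : Type*} [NormedAddCommGroup H] [InnerProductSpace ℂ H] [CompleteSpace H]

/-- The defect operator with values in the defect space. -/
noncomputable def defectTo (f : PosRegFreeHol n) (X : Fin n → H →L[ℂ] H) :
    H →L[ℂ] defectSpace f X :=
  (defect f X).codRestrict _ fun x => Submodule.le_topologicalClosure _ ⟨x, rfl⟩

/-- The Poisson kernel with values in the `ℓ²`-space over the words. -/
theorem IsContractiveFor.exists_poissonKernel {f : PosRegFreeHol n} {X : Fin n → H →L[ℂ] H}
    (hX : IsContractiveFor f X) :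
    ∃ K : H →L[ℂ] lp (fun _ : List (Fin n) => defectSpace f X) 2,
      (∀ x α, K x α = (√(bCoeff f α) : ℂ) • defectTo f X (adjoint (wordOp X α) x)) ∧
      ∀ x, ‖K x‖ₑ ^ 2 = poissonForm f X x := by
  let S : List (Fin n) → H →L[ℂ] defectSpace f X := fun α =>
    (√(bCoeff f α) : ℂ) • (defectTo f X ∘L adjoint (wordOp X α))
  have hS : ∀ x, ∑' α, ‖S α x‖ₑ ^ 2 = poissonForm f X x := by
    refine fun x => tsum_congr fun α => ?_
    rw [smul_apply, enorm_smul, mul_pow, enorm_sq_eq_ofReal,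
      Complex.norm_real, Real.norm_eq_abs, sq_abs, Real.sq_sqrt (bCoeff_nonneg f α)]
    rfl
  obtain ⟨K, hK⟩ := exists_toLp_of_tsum_le S 1 fun x => by
    rw [hS, ENNReal.coe_one, one_mul]
    exact hX.poissonForm_le x
  exact ⟨K, hK, fun x => by rw [← hS, lp_enorm_sq]; simp only [hK]⟩

/-- The adjoint of the Poisson kernel intertwines `W_i ⊗ I` and `X_i`. -/
theorem adjoint_poissonKernel_lpSmul {f : PosRegFreeHol n} {X : Fin n → H →L[ℂ] H}
    {K : H →L[ℂ] lp (fun _ : List (Fin n) => defectSpace f X) 2}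
    (hK : ∀ x α, K x α = (√(bCoeff f α) : ℂ) • defectTo f X (adjoint (wordOp X α) x))
    (i : Fin n) (φ : Fock n) (y : defectSpace f X) :
    adjoint K (lpSmul (weightedShift f i φ) y) = X i (adjoint K (lpSmul φ y)) := by
  have hsingle : ∀ α, adjoint K (lpSmul (basisVec α) y)
      = (√(bCoeff f α) : ℂ) • wordOp X α (adjoint (defectTo f X) y) := by
    intro α
    refine ext_inner_right ℂ fun x => ?_
    rw [ContinuousLinearMap.adjoint_inner_left, lpSmul_basisVec, lp.inner_single_left, hK, inner_smul_right,
      inner_smul_left, Complex.conj_ofReal, ← ContinuousLinearMap.adjoint_inner_right,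
      ContinuousLinearMap.adjoint_inner_left]
  have h : adjoint K ∘L (lpSmulL (List (Fin n)) (defectSpace f X)).flip y ∘L weightedShift f i
      = X i ∘L adjoint K ∘L (lpSmulL (List (Fin n)) (defectSpace f X)).flip y := by
    refine fock_ext fun α => ?_
    simp only [ContinuousLinearMap.comp_apply, weightedShift_basisVec, map_smul,
      ContinuousLinearMap.flip_apply, lpSmulL_apply, hsingle, smul_smul, wordOp_cons]
    -- The weight of `W_i` turns the factor `√b_{g_i α}` of the kernel into `√b_α`.
    rw [Real.sqrt_div' _ (bCoeff_nonneg f _), Complex.ofReal_div, div_mul_cancel₀]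
    exact Complex.ofReal_ne_zero.2 (Real.sqrt_pos.2 (bCoeff_pos f _)).ne'
  exact DFunLike.congr_fun h φ

theorem mem_idealRange_of_orthogonal {J : Submodule ℂ (Fock n →L[ℂ] Fock n)} {φ : Fock n}
    (h : φ ∈ (modelSpace J)ᗮ) : φ ∈ idealRange J := by
  rw [Submodule.orthogonal_orthogonal_eq_closure, idealRange,
    (Submodule.isClosed_topologicalClosure _).submodule_topologicalClosure_eq] at h
  exact h

/-- The constrained Poisson kernel of a tuple in the variety. -/
theorem IsContractiveFor.exists_constrained_poissonKernel {f : PosRegFreeHol n}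
    {X : Fin n → H →L[ℂ] H} (hX : IsContractiveFor f X) {P : Set (FreeAlgebra ℂ (Fin n))}
    (hP : ∀ q ∈ P, FreeAlgebra.lift ℂ X q = 0) :
    ∃ k : H →L[ℂ] HilbertTensor (modelSpace (generatedIdeal f P)) (defectSpace f X),
      (∀ x, ‖k x‖ₑ ^ 2 = poissonForm f X x) ∧
      ∀ i x, adjoint (ampliate (modelOp f (generatedIdeal f P) i)) (k x)
        = k (adjoint (X i) x) := by
  obtain ⟨K, hK, hKn⟩ := hX.exists_poissonKernel
  obtain ⟨k, hk, hkB⟩ := exists_compression_to_tensor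
    (modelSpace (generatedIdeal f P)).subtypeₗᵢ K fun φ hφ y =>
      apply_eq_zero_of_mem_idealRange hP
        (adjoint K ∘L (lpSmulL (List (Fin n)) (defectSpace f X)).flip y)
        (fun i φ => adjoint_poissonKernel_lpSmul hK i φ y)
        (mem_idealRange_of_orthogonal ((Submodule.mem_orthogonal' _ _).2 fun e he => hφ ⟨e, he⟩))
  refine ⟨k, fun x => (enorm_sq_eq_iff.2 (hk x)).trans (hKn x), fun i x => ?_⟩
  refine hkB (weightedShift f i) (X i) _ (fun e => ?_)
    (fun φ y => adjoint_poissonKernel_lpSmul hK i φ y) x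
  refine ext_inner_right ℂ fun e' => ?_
  rw [ContinuousLinearMap.adjoint_inner_left]
  exact Submodule.inner_orthogonalProjectionOnto_eq_of_mem_right e' _

end

section

variable {n : ℕ} {H : Type u} [NormedAddCommGroup H] [InnerProductSpace ℂ H] [CompleteSpace H]

open ContinuousLinearMap (adjoint)

/-! ## The residual part -/

theorem adjoint_wordOp_intertwining {K : Type*} [NormedAddCommGroup K] [InnerProductSpace ℂ K]
    [CompleteSpace K] {X : Fin n → H →L[ℂ] H} {U : Fin n → K →L[ℂ] K} {S : H →L[ℂ] K}
    (h : ∀ i x, adjoint (U i) (S x) = S (adjoint (X i) x)) (α : List (Fin n)) (x : H) :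
    adjoint (wordOp U α) (S x) = S (adjoint (wordOp X α) x) := by
  induction α generalizing x with
  | nil => simp only [adjoint_wordOp_nil]
  | cons i α ih =>
    rw [wordOp_cons, wordOp_cons, ContinuousLinearMap.adjoint_comp,
      ContinuousLinearMap.adjoint_comp, ContinuousLinearMap.comp_apply, h, ih]
    rfl

/-- Keep only the one-letter word in the series. The bound makes `R x ↦ R X_i* x` well defined and
continuous; here `a_{g_i} > 0` is essential. -/
theorem norm_apply_adjoint_le {f : PosRegFreeHol n} {X : Fin n → H →L[ℂ] H} {R : H →L[ℂ] H}
    (hR : ∀ x, ∑' α, ENNReal.ofReal (f.coeff α) * ‖R (adjoint (wordOp X α) x)‖ₑ ^ 2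
      = ‖R x‖ₑ ^ 2) (i : Fin n) (x : H) :
    ‖R (adjoint (X i) x)‖ ≤ (√(f.coeff [i]))⁻¹ * ‖R x‖ := by
  have h := (ENNReal.le_tsum [i]).trans_eq (hR x)
  have hpos := Real.sqrt_pos.2 (f.coeff_letter_pos i)
  have h1 : ‖(√(f.coeff [i]) : ℂ) • R (adjoint (X i) x)‖ₑ ^ 2 ≤ ‖R x‖ₑ ^ 2 := by
    refine le_trans (le_of_eq ?_) h
    rw [enorm_smul, mul_pow, enorm_sq_eq_ofReal, Complex.norm_real, Real.norm_eq_abs, sq_abs,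
      Real.sq_sqrt (f.coeff_nonneg _), wordOp_singleton]
  rw [enorm_sq_le_iff, norm_smul, Complex.norm_real, Real.norm_eq_abs, abs_of_pos hpos] at h1
  rwa [inv_mul_eq_div, le_div_iff₀' hpos]

/-- An operator `R` with `∑ a_α ‖R X_α* x‖² = ‖R x‖²` gives, on the closure of its range, a tuple
`U` with `U_i* R = R X_i*` and `∑ a_α U_α U_α* = I`. -/
theorem exists_residual {f : PosRegFreeHol n} {X : Fin n → H →L[ℂ] H} {R : H →L[ℂ] H}
    (hR : ∀ x, ∑' α, ENNReal.ofReal (f.coeff α) * ‖R (adjoint (wordOp X α) x)‖ₑ ^ 2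
      = ‖R x‖ₑ ^ 2) :
    ∃ (K : Type u) (_ : NormedAddCommGroup K) (_ : InnerProductSpace ℂ K) (_ : CompleteSpace K)
      (S : H →L[ℂ] K) (U : Fin n → K →L[ℂ] K), DenseRange S ∧ (∀ x, ‖S x‖ = ‖R x‖) ∧
        (∀ i x, adjoint (U i) (S x) = S (adjoint (X i) x)) ∧
        U ∈ domain K f ∧ phi f U 1 = 1 := by
  let M : Submodule ℂ H := (LinearMap.range R.toLinearMap).topologicalClosure
  let S : H →L[ℂ] M := R.codRestrict M fun x => Submodule.le_topologicalClosure _ ⟨x, rfl⟩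
  have hcomplete : CompleteSpace M :=
    inferInstanceAs (CompleteSpace (Submodule.topologicalClosure _))
  have hSn : ∀ x, ‖S x‖ = ‖R x‖ := fun x => rfl
  have hSe : ∀ x, ‖S x‖ₑ = ‖R x‖ₑ := fun x => rfl
  have hS : DenseRange S := by
    intro y
    rw [Metric.mem_closure_iff]
    intro ε hε
    obtain ⟨_, ⟨x, rfl⟩, hx⟩ := Metric.mem_closure_iff.1 y.2 ε hε
    exact ⟨S x, ⟨x, rfl⟩, hx⟩
  let C : Fin n → M →L[ℂ] M := fun i =>
    (S ∘L adjoint (X i)).toLinearMap.extendOfNorm S.toLinearMap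
  have hC : ∀ i x, C i (S x) = S (adjoint (X i) x) := fun i x =>
    LinearMap.extendOfNorm_eq (f := (S ∘L adjoint (X i)).toLinearMap) (e := S.toLinearMap) hS
      ⟨_, norm_apply_adjoint_le hR i⟩ x
  let U : Fin n → M →L[ℂ] M := fun i => adjoint (C i)
  have hU : ∀ i x, adjoint (U i) (S x) = S (adjoint (X i) x) := fun i x => by
    rw [ContinuousLinearMap.adjoint_adjoint, hC]
  have hUS : ∀ x, ∑' α, ENNReal.ofReal (f.coeff α) * ‖adjoint (wordOp U α) (S x)‖ₑ ^ 2
      = ‖S x‖ₑ ^ 2 := by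
    intro x
    simp only [adjoint_wordOp_intertwining hU, hSe, hR]
  -- Finite partial sums are continuous, so the inequality passes from the dense range of `S` to the
  -- whole space.
  have hcontr : IsContractiveFor f U := by
    intro y
    rw [ENNReal.tsum_eq_iSup_sum]
    refine iSup_le fun s => ?_
    refine hS.induction_on (p := fun y => ∑ α ∈ s, ENNReal.ofReal (f.coeff α)
      * ‖adjoint (wordOp U α) y‖ₑ ^ 2 ≤ ‖y‖ₑ ^ 2) y ?_ fun x => ?_
    · refine isClosed_le (continuous_finsetSum s fun α _ => ?_) ?_
      · refine (ENNReal.continuous_const_mul ENNReal.ofReal_ne_top).comp ?_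
        exact (ENNReal.continuous_pow 2).comp (adjoint (wordOp U α)).continuous.enorm
      · exact (ENNReal.continuous_pow 2).comp continuous_enorm
    · exact (ENNReal.sum_le_tsum s).trans_eq (hUS x)
  obtain ⟨-, V, -, hV⟩ := hcontr.exists_phi_eq (1 : M →L[ℂ] M)
  -- Equality of the full series does not pass to limits termwise; the bounded operator `V` encodes
  -- the series as a continuous norm.
  have heq : ∀ y, ‖V y‖ = ‖y‖ := fun y =>
    hS.induction_on y (isClosed_eq V.continuous.norm continuous_norm) fun x =>
      enorm_sq_eq_iff.1 ((hV (S x)).trans (hUS x))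
  exact ⟨M, inferInstance, inferInstance, hcomplete, S, U, hS, hSn, hU,
    hcontr.mem_domain fun y => (hV y).symm.trans (enorm_sq_eq_iff.2 (heq y))⟩

/-- Here `S*` intertwines `U` with `X`, so `S* q(U) = q(X) S* = 0`, and `S*` is injective because
`S` has dense range. -/
theorem lift_eq_zero_of_denseRange {K : Type*} [NormedAddCommGroup K] [InnerProductSpace ℂ K]
    [CompleteSpace K] {X : Fin n → H →L[ℂ] H} {U : Fin n → K →L[ℂ] K} {S : H →L[ℂ] K}
    (hS : DenseRange S) (h : ∀ i x, adjoint (U i) (S x) = S (adjoint (X i) x))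
    {q : FreeAlgebra ℂ (Fin n)} (hq : FreeAlgebra.lift ℂ X q = 0) :
    FreeAlgebra.lift ℂ U q = 0 := by
  have h1 : ∀ i y, adjoint S (U i y) = X i (adjoint S y) := by
    intro i y
    refine ext_inner_right ℂ fun x => ?_
    rw [ContinuousLinearMap.adjoint_inner_left, ← ContinuousLinearMap.adjoint_inner_right, h,
      ← ContinuousLinearMap.adjoint_inner_left, ContinuousLinearMap.adjoint_inner_right]
  ext1 y
  have h2 := lift_apply_of_intertwining (adjoint S) h1 q y
  rw [hq] at h2
  refine ext_inner_right ℂ fun z => ?_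
  refine hS.induction_on z (isClosed_eq (by fun_prop) (by fun_prop)) fun x => ?_
  rw [← ContinuousLinearMap.adjoint_inner_left, h2]
  simp

/-- Subtract `poissonForm_eq` from `defect_add`; cancellation in `ℝ≥0∞` is legitimate because the
Poisson form is finite. -/
theorem tsum_coeff_mul_eq_of_add_poissonForm {f : PosRegFreeHol n} {X : Fin n → H →L[ℂ] H}
    (hX : IsContractiveFor f X) {R : H →L[ℂ] H}
    (hR : ∀ x, ‖R x‖ₑ ^ 2 + poissonForm f X x = ‖x‖ₑ ^ 2) (x : H) :
    ∑' α, ENNReal.ofReal (f.coeff α) * ‖R (adjoint (wordOp X α) x)‖ₑ ^ 2 = ‖R x‖ₑ ^ 2 := by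
  have hfin : poissonForm f X x ≠ ∞ := ne_top_of_le_ne_top (by simp) (hX.poissonForm_le x)
  refine (ENNReal.add_left_inj hfin).1 ?_
  rw [hR, ← hX.defect_add x, poissonForm_eq, add_left_comm, ← ENNReal.tsum_add]
  simp only [← mul_add, hR]

/-- The residual part vanishes exactly for pure tuples. -/
theorem IsContractiveFor.isPure_iff_residual {f : PosRegFreeHol n} {X : Fin n → H →L[ℂ] H}
    (hX : IsContractiveFor f X) {R : H →L[ℂ] H}
    (hR : ∀ x, ‖R x‖ₑ ^ 2 + poissonForm f X x = ‖x‖ₑ ^ 2) :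
    IsPure f X ↔ ∀ x, R x = 0 := by
  rw [hX.isPure_iff]
  constructor
  · intro h x
    -- The form `‖R x‖²` is fixed by `Φ` and starts below `‖x‖²`, so monotonicity keeps it below
    -- every iterate.
    have hle : ∀ m x, ‖R x‖ₑ ^ 2 ≤ phiForm f X m x := by
      intro m
      induction m with
      | zero => exact fun x => le_self_add.trans_eq (hR x)
      | succ m ih =>
        intro x
        rw [← tsum_coeff_mul_eq_of_add_poissonForm hX hR x]
        exact ENNReal.tsum_le_tsum fun α => mul_le_mul_right (ih _) _
    have h0 := ge_of_tendsto' (h x) fun m => hle m x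
    simpa using h0
  · intro h
    refine tendsto_phiForm_of_poissonForm_eq fun x => ?_
    rw [← hR x, h]
    simp

/-! ### Direct sums and assembly of the dilation -/

theorem adjoint_blockDiag {E F : Type*} [NormedAddCommGroup E] [InnerProductSpace ℂ E]
    [CompleteSpace E] [NormedAddCommGroup F] [InnerProductSpace ℂ F] [CompleteSpace F]
    (A : E →L[ℂ] E) (B : F →L[ℂ] F) :
    adjoint (blockDiag A B) = blockDiag (adjoint A) (adjoint B) := by
  refine ((ContinuousLinearMap.eq_adjoint_iff _ _).2 fun x y => ?_).symm
  simp only [WithLp.prod_inner_apply]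
  exact congrArg₂ (· + ·) (ContinuousLinearMap.adjoint_inner_left A _ _)
    (ContinuousLinearMap.adjoint_inner_left B _ _)

theorem blockDiag_toLp {E F : Type*} [NormedAddCommGroup E] [InnerProductSpace ℂ E]
    [NormedAddCommGroup F] [InnerProductSpace ℂ F] (A : E →L[ℂ] E) (B : F →L[ℂ] F) (x : E) (y : F) :
    blockDiag A B (WithLp.toLp 2 (x, y)) = WithLp.toLp 2 (A x, B y) := rfl

/-- Two operators with `‖k x‖² + ‖S x‖² = ‖x‖²` form an isometry into the direct sum, which
intertwines the adjoints of block diagonal operators when both components do. -/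
theorem exists_isometry_hilbertSum {E F : Type*} [NormedAddCommGroup E] [InnerProductSpace ℂ E]
    [CompleteSpace E] [NormedAddCommGroup F] [InnerProductSpace ℂ F] [CompleteSpace F]
    {X : Fin n → H →L[ℂ] H} {A : Fin n → E →L[ℂ] E} {B : Fin n → F →L[ℂ] F}
    {k : H →L[ℂ] E} {S : H →L[ℂ] F} (h : ∀ x, ‖k x‖ ^ 2 + ‖S x‖ ^ 2 = ‖x‖ ^ 2)
    (hk : ∀ i x, adjoint (A i) (k x) = k (adjoint (X i) x))
    (hS : ∀ i x, adjoint (B i) (S x) = S (adjoint (X i) x)) :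
    ∃ (V : Fin n → HilbertSum E F →L[ℂ] HilbertSum E F) (ι : H →ₗᵢ[ℂ] HilbertSum E F),
      (∀ i, V i = blockDiag (A i) (B i)) ∧
      (∀ i, ∀ x ∈ LinearMap.range ι.toLinearMap,
        adjoint (V i) x ∈ LinearMap.range ι.toLinearMap) ∧
      ∀ i x, adjoint (V i) (ι x) = ι (adjoint (X i) x) := by
  let ι : H →ₗᵢ[ℂ] HilbertSum E F :=
    ⟨(WithLp.linearEquiv 2 ℂ (E × F)).symm.toLinearMap ∘ₗ (k.prod S).toLinearMap, fun x => by
      rw [← sq_eq_sq₀ (norm_nonneg _) (norm_nonneg _), ← h x, WithLp.prod_norm_sq_eq_of_L2]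
      rfl⟩
  have hι : ∀ x, ι x = WithLp.toLp 2 (k x, S x) := fun x => rfl
  have hadj : ∀ i x, adjoint (blockDiag (A i) (B i)) (ι x) = ι (adjoint (X i) x) :=
    fun i x => by rw [hι, hι, adjoint_blockDiag, blockDiag_toLp, hk, hS]
  refine ⟨fun i => blockDiag (A i) (B i), ι, fun i => rfl, ?_, hadj⟩
  rintro i _ ⟨x, rfl⟩
  exact ⟨_, (hadj i x).symm⟩

/-- A dilation of a tuple in the variety from a realization `k` of its Poisson kernel. -/
theorem IsContractiveFor.exists_dilation {f : PosRegFreeHol n} {X : Fin n → H →L[ℂ] H}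
    (hc : IsContractiveFor f X) {P : Set (FreeAlgebra ℂ (Fin n))}
    (hP : ∀ q ∈ P, FreeAlgebra.lift ℂ X q = 0) {E : Type*} [NormedAddCommGroup E]
    [InnerProductSpace ℂ E] [CompleteSpace E] {A : Fin n → E →L[ℂ] E} {k : H →L[ℂ] E}
    (hk : ∀ x, ‖k x‖ₑ ^ 2 = poissonForm f X x)
    (hkX : ∀ i x, adjoint (A i) (k x) = k (adjoint (X i) x)) :
    ∃ (K : Type u) (_ : NormedAddCommGroup K) (_ : InnerProductSpace ℂ K) (_ : CompleteSpace K)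
      (U : Fin n → K →L[ℂ] K) (V : Fin n → HilbertSum E K →L[ℂ] HilbertSum E K)
      (ι : H →ₗᵢ[ℂ] HilbertSum E K),
      U ∈ variety K f P ∧
      phi f U 1 = 1 ∧
      (∀ i, V i = blockDiag (A i) (U i)) ∧
      (∀ i, ∀ x ∈ LinearMap.range ι.toLinearMap,
        adjoint (V i) x ∈ LinearMap.range ι.toLinearMap) ∧
      (∀ i h, adjoint (V i) (ι h) = ι (adjoint (X i) h)) ∧
      (Subsingleton K ↔ IsPure f X) := by
  -- The witness is `R = (I - k* k)^{1/2}`.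
  obtain ⟨R, hR⟩ : ∃ R : H →L[ℂ] H, ∀ x, ‖R x‖ ^ 2 + ‖k x‖ ^ 2 = ‖x‖ ^ 2 :=
    ⟨_, norm_sq_sqrt_one_sub k fun x => (hk x).trans_le (hc.poissonForm_le x)⟩
  have hRp : ∀ x, ‖R x‖ₑ ^ 2 + poissonForm f X x = ‖x‖ₑ ^ 2 := fun x => by
    rw [← hk, enorm_sq_add_of_norm_sq_add (hR x)]
  obtain ⟨K, _, _, _, S, U, hS, hSn, hU, hUd, hU1⟩ :=
    exists_residual (tsum_coeff_mul_eq_of_add_poissonForm hc hRp)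
  obtain ⟨V, ι, hV, hrange, hadj⟩ := exists_isometry_hilbertSum
    (fun x => by rw [hSn, add_comm, hR]) hkX hU
  refine ⟨K, inferInstance, inferInstance, inferInstance, U, V, ι,
    ⟨hUd, fun q hq => lift_eq_zero_of_denseRange hS hU (hP q hq)⟩, hU1, hV, hrange, hadj, ?_⟩
  rw [hc.isPure_iff_residual hRp]
  constructor
  · intro _ x
    rw [← norm_eq_zero, ← hSn, Subsingleton.elim (S x) 0, norm_zero]
  · intro h
    refine subsingleton_of_forall_eq 0 fun y => ?_
    refine hS.induction_on y (isClosed_eq continuous_id continuous_const) fun x => ?_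
    rw [← norm_eq_zero, hSn, h, norm_zero]

end

end NCVariety

theorem mainTheorem12 {n : ℕ} (f : PosRegFreeHol n) (P : Set (FreeAlgebra ℂ (Fin n)))
    (hJ : (generatedIdeal f P : Set (Fock n →L[ℂ] Fock n)) ≠ hardy f)
    {H : Type u} [NormedAddCommGroup H] [InnerProductSpace ℂ H] [CompleteSpace H]
    (T : Fin n → H →L[ℂ] H) (hT : T ∈ variety H f P) :
    ∃ (K : Type u) (_ : NormedAddCommGroup K) (_ : InnerProductSpace ℂ K) (_ : CompleteSpace K)
      (U : Fin n → K →L[ℂ] K)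
      (V : Fin n →
        HilbertSum (HilbertTensor (modelSpace (generatedIdeal f P)) (defectSpace f T)) K →L[ℂ]
          HilbertSum (HilbertTensor (modelSpace (generatedIdeal f P)) (defectSpace f T)) K)
      (ι : H →ₗᵢ[ℂ]
        HilbertSum (HilbertTensor (modelSpace (generatedIdeal f P)) (defectSpace f T)) K),
      U ∈ variety K f P ∧
      phi f U 1 = 1 ∧
      (∀ i, V i = blockDiag (ampliate (modelOp f (generatedIdeal f P) i)) (U i)) ∧
      (∀ i, ∀ x ∈ LinearMap.range ι.toLinearMap,
        ContinuousLinearMap.adjoint (V i) x ∈ LinearMap.range ι.toLinearMap) ∧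
      (∀ i h, ContinuousLinearMap.adjoint (V i) (ι h) = ι (ContinuousLinearMap.adjoint (T i) h)) ∧
      (Subsingleton K ↔ IsPure f T) := by
  have hc : IsContractiveFor f T := tsum_coeff_le_of_mem_domain hT.1
  obtain ⟨k, hk, hkT⟩ := hc.exists_constrained_poissonKernel hT.2
  exact hc.exists_dilation hT.2 hk hkT
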